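/- Let $\mathbb{C}(v)$ be the field of rational functions in one variable $v$, and write $[2]=v+v^{-1}$. Let $MU_v(2)$ be the unital associative $\mathbb{C}(v)$-algebra with generators $e,f,k,k^{-1},\ell$ and relations $$kk^{-1}=k^{-1}k=1,\qquad kek^{-1}=v^2e,\qquad kfk^{-1}=v^{-2}f,\qquad ef-fe=\frac{k-k^{-1}}{v-v^{-1}},$$ $$\ell^2=\ell,\qquad k\ell=\ell k,\qquad \ell e\ell=\ell e,\qquad \ell f\ell=f\ell,$$ $$[2]\,e\ell e=v^{-1}e^2\ell+v\,\ell e^2,\qquad [2]\,f\ell f=v^{-1}\ell f^2+v f^2\ell .$$ Put $$C_{mir}=(1-v^{-2})\left(fe+\frac{kv+k^{-1}v^{-1}}{(v-v^{-1})^2}\right)-fe\ell-\ell fe+v^2f\ell e+v^{-2}e\ell f+(v^2-2)\,\ell\,\frac{kv+k^{-1}v^{-1}}{(v-v^{-1})^2}+v^{-2}\,\ell\,\frac{kv^{-1}+k^{-1}v}{(v-v^{-1})^2}.$$ Then: 1. $C_{mir}$ lies in the center of $MU_v(2)$. 2. $C_{mir}$ acts by a scalar in $\mathbb{C}(v)$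 on every simple $MU_v(2)$-module that is finite-dimensional over $\mathbb{C}(v)$, and the scalars on two non-isomorphic such modules are distinct. 3. Every $MU_v(2)$-module that is finite-dimensional over $\mathbb{C}(v)$ is a (finite) direct sum of simple $MU_v(2)$-submodules. -/

import Mathlib

universe u w

/-- The ground field `ℂ(v)` of rational functions in one variable. -/
abbrev Kv : Type := RatFunc ℂ

namespace MirabolicSl2

noncomputable section

/-- The indeterminate `v` of `ℂ(v)`. -/
def v : Kv := RatFunc.X

/-- The symmetric quantum integer `[m] = (v ^ m - v ^ (-m)) / (v - v⁻¹)`. -/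
def qInt (m : ℕ) : Kv := (v ^ m - v⁻¹ ^ m) / (v - v⁻¹)

/-- Names of the Chevalley generators `e, f, k, k⁻¹, ℓ`. -/
inductive Gen : Type
  | e | f | k | kInv | l

/-- The generators inside the free algebra. -/
abbrev ι (g : Gen) : FreeAlgebra Kv Gen := FreeAlgebra.ι Kv g

/-- The defining relations of mirabolic quantum `sl₂`. -/
inductive Rel : FreeAlgebra Kv Gen → FreeAlgebra Kv Gen → Prop
  | k_kInv : Rel (ι .k * ι .kInv) 1
  | kInv_k : Rel (ι .kInv * ι .k) 1
  | k_e : Rel (ι .k * ι .e * ι .kInv) (v ^ 2 • ι .e)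
  | k_f : Rel (ι .k * ι .f * ι .kInv) (v⁻¹ ^ 2 • ι .f)
  | e_f : Rel (ι .e * ι .f - ι .f * ι .e) ((v - v⁻¹)⁻¹ • (ι .k - ι .kInv))
  | l_l : Rel (ι .l ^ 2) (ι .l)
  | k_l : Rel (ι .k * ι .l) (ι .l * ι .k)
  | l_e_l : Rel (ι .l * ι .e * ι .l) (ι .l * ι .e)
  | l_f_l : Rel (ι .l * ι .f * ι .l) (ι .f * ι .l)
  | e_l_e : Rel (qInt 2 • (ι .e * ι .l * ι .e))
      (v⁻¹ • (ι .e ^ 2 * ι .l) + v • (ι .l * ι .e ^ 2))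
  | f_l_f : Rel (qInt 2 • (ι .f * ι .l * ι .f))
      (v⁻¹ • (ι .l * ι .f ^ 2) + v • (ι .f ^ 2 * ι .l))

end

end MirabolicSl2

/-- Mirabolic quantum `sl₂`: the unital associative `ℂ(v)`-algebra with generators
`e, f, k, k⁻¹, ℓ` and the relations `MirabolicSl2.Rel`. -/
def MU : Type := RingQuot MirabolicSl2.Rel

namespace MU

noncomputable section

open MirabolicSl2 (Gen v)

instance : Ring MU := inferInstanceAs (Ring (RingQuot MirabolicSl2.Rel))

instance : Algebra Kv MU := inferInstanceAs (Algebra Kv (RingQuot MirabolicSl2.Rel))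

/-- The image in `MU` of a generator. -/
def gen (g : Gen) : MU := RingQuot.mkAlgHom Kv MirabolicSl2.Rel (FreeAlgebra.ι Kv g)

/-- The generator `e`. -/
def e : MU := gen .e
/-- The generator `f`. -/
def f : MU := gen .f
/-- The generator `k`. -/
def k : MU := gen .k
/-- The generator `k⁻¹`. -/
def kInv : MU := gen .kInv
/-- The idempotent generator `ℓ`. -/
def l : MU := gen .l

/-- The element `(k v + k⁻¹ v⁻¹) / (v - v⁻¹) ^ 2`. -/
def kPlus : MU := ((v - v⁻¹) ^ 2)⁻¹ • (v • k + v⁻¹ • kInv)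

/-- The element `(k v⁻¹ + k⁻¹ v) / (v - v⁻¹) ^ 2`. -/
def kMinus : MU := ((v - v⁻¹) ^ 2)⁻¹ • (v⁻¹ • k + v • kInv)

/-- The mirabolic quantum Casimir element. -/
def casimir : MU :=
  (1 - v⁻¹ ^ 2) • (f * e + kPlus) - f * e * l - l * f * e + v ^ 2 • (f * l * e)
    + v⁻¹ ^ 2 • (e * l * f) + (v ^ 2 - 2) • (l * kPlus) + v⁻¹ ^ 2 • (l * kMinus)

end

end MU

/-!
Write `[k] = (k - k⁻¹) / (v - v⁻¹)`. With respect to the idempotent `ℓ` the generators are block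
triangular: `e = E + x` and `f = G + y`, where `E`, `G` commute with `ℓ`, while
`x = (1 - ℓ) x ℓ` and `y = ℓ y (1 - ℓ)` are off-diagonal. In terms of blocks the relations become
`[E, G] = [k] - x y + y x`, `x G = G x`, `y E = E y`, `E x = v² x E`, `y G = v² G y`
(`MirabolicRelations.blockRelations`). Moving `E` and `G` past `x` and `y` in two ways gives
`x y x = v⁻¹ x k⁻¹` and `y x y = v y k⁻¹`, so that `P = v⁻¹ x y k + v y x k` is a central
idempotent. On the factor `P = 1` the elements `X = v x k` and `Y = y` are off-diagonal
`2 × 2` matrix units, and on the factor `P = 0` both `x` and `y` vanish. After rescaling the diagonal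
blocks of `G` and `k` by powers of `v` on the factor `P = 1`, the elements `E, F, T` form a quantum
`sl₂`-triple that commutes with `P, ℓ, X, Y` (`BlockRelations.matrixTriple`). Hence the
algebra is quantum `sl₂` tensored with `ℂ(v) × ℂ(v) × M₂(ℂ(v))`, and the mirabolic Casimir
element is `v - v⁻¹` times the Casimir element of quantum `sl₂` times a central element of the second
tensor factor (`BlockRelations.casimir_eq`), which makes it central (`MatrixTriple.mem_center`).

The representation theory is then the classical one at a parameter that is not a root of unity.
In finite-dimensional modules `E` and `F` are nilpotent, and on the kernel of `E` the element
`E ^ N * F ^ N` is a polynomial in `T` with simple roots `± v ^ s`; therefore highest weights are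
`± v ^ n` with `n ≥ 0`. A highest weight vector generates a simple module
(`MatrixTriple.isSimpleModule_span`), and this module is determined by the sign, by `n` and by one
of three blocks (`MatrixTriple.nonempty_linearEquiv`). Up to a common factor the Casimir element acts
on it by `± (v ^ (n + j) + v ^ (j - n - 2))`, with `j = 0, 1, 2` according to the block, and these
scalars are distinct (`MirabolicSl2.label_eq_of_casimirScalar_eq`). Complete reducibility
(`MatrixTriple.isSemisimpleModule`) holds because `E` maps the weight space of a dominant weight
onto the next one (`QuantumTriple.exists_E_smul_eq`): this allows a highest weight vector of the
quotient by the sum of all simple submodules to be lifted to a highest weight vector.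
-/

section

open Polynomial

/-! ### Finite-dimensional modules over a quantum `sl₂`-triple -/

/-- Elements `E, F, T, T⁻¹` of a `K`-algebra that satisfy the defining relations of
quantum `sl₂` at the parameter `q`. -/
structure QuantumTriple {K A : Type*} [Field K] [Ring A] [Algebra K A]
    (q : K) (E F T T' : A) : Prop where
  T_T' : T * T' = 1
  T'_T : T' * T = 1
  T_E : T * E = q ^ 2 • (E * T)
  F_T : F * T = q ^ 2 • (T * F)
  E_F : E * F - F * E = (q - q⁻¹)⁻¹ • (T - T')

/-- If conjugation by a unit rescales `a` by a scalar that is not a root of unity, then `a` acts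
nilpotently on finite-dimensional modules: the minimal polynomial of `a` is invariant under
rescaling the variable, hence is a monomial. -/
theorem exists_pow_smul_eq_zero_of_mul_eq_smul_mul {K A M : Type*} [Field K] [Ring A] [Algebra K A]
    [AddCommGroup M] [Module K M] [Module A M] [IsScalarTower K A M] [FiniteDimensional K M]
    {T T' a : A} {c : K} (hT : T' * T = 1) (hT' : T * T' = 1) (ha : T * a = c • (a * T))
    (hc0 : c ≠ 0) (hc : ∀ n : ℕ, 0 < n → c ^ n ≠ 1) :
    ∃ N : ℕ, ∀ m : M, a ^ N • m = 0 := by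
  set φ : A →ₐ[K] Module.End K M := Algebra.lsmul K K M with hφ
  set p := minpoly K (φ a) with hp
  have hint : IsIntegral K (φ a) := Algebra.IsIntegral.isIntegral _
  have hpm : p.Monic := minpoly.monic hint
  have hconj : φ T * φ a * φ T' = c • φ a := by
    rw [← map_mul, ← map_mul, ← map_smul, ha, smul_mul_assoc, mul_assoc, hT', mul_one]
  have hTT : φ T' * φ T = 1 := by rw [← map_mul, hT, map_one]
  have hTT' : φ T * φ T' = 1 := by rw [← map_mul, hT', map_one]
  have hpow : ∀ n : ℕ, φ T * (φ a) ^ n * φ T' = (c • φ a) ^ n := by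
    intro n
    induction n with
    | zero => simp [hTT']
    | succ n ih =>
      rw [pow_succ, pow_succ, ← ih, ← hconj]
      calc φ T * (φ a ^ n * φ a) * φ T' = φ T * φ a ^ n * 1 * φ a * φ T' := by noncomm_ring
        _ = _ := by rw [← hTT]; noncomm_ring
  have haev : ∀ r : K[X], aeval (c • φ a) r = φ T * aeval (φ a) r * φ T' := by
    intro r
    induction r using Polynomial.induction_on' with
    | add r s hr hs => simp [hr, hs, mul_add, add_mul]
    | monomial n b =>
      rw [aeval_monomial, aeval_monomial, ← hpow, Algebra.algebraMap_eq_smul_one]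
      simp [mul_assoc]
  have hcomp : aeval (φ a) (p.comp (C c * X)) = 0 := by
    rw [aeval_comp]
    have : aeval (φ a) (C c * X) = c • φ a := by
      simp [Algebra.smul_def]
    rw [this, haev, hp, minpoly.aeval]; simp
  have hdeg : (p.comp (C c * X)).natDegree = p.natDegree := by
    rw [natDegree_comp, natDegree_C_mul_X _ hc0, mul_one]
  have hdvd : p ∣ p.comp (C c * X) := minpoly.dvd _ _ hcomp
  obtain ⟨r, hr⟩ := hdvd
  have hne : p.comp (C c * X) ≠ 0 := by
    intro h0
    have := congrArg (fun s => coeff s p.natDegree) h0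
    simp [comp_C_mul_X_coeff, hpm.coeff_natDegree, hc0] at this
  have hr0 : r ≠ 0 := by rintro rfl; simp [hne] at hr
  have hrdeg : r.natDegree = 0 := by
    have := congrArg natDegree hr
    rw [hdeg, natDegree_mul hpm.ne_zero hr0] at this
    omega
  obtain ⟨d, hd⟩ := natDegree_eq_zero.mp hrdeg
  rw [← hd] at hr
  have hcoef : ∀ i, p.coeff i * c ^ i = p.coeff i * d := by
    intro i
    have := congrArg (fun s => coeff s i) hr
    simpa [comp_C_mul_X_coeff] using this
  have hd' : c ^ p.natDegree = d := by
    simpa [hpm.coeff_natDegree] using hcoef p.natDegree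
  have hmon : p = X ^ p.natDegree := by
    ext i
    rw [coeff_X_pow]
    split_ifs with hi
    · rw [hi]; exact hpm.coeff_natDegree
    · by_contra hne0
      rcases lt_or_gt_of_ne hi with h | h
      · have h1 := mul_left_cancel₀ hne0 (hcoef i)
        rw [← hd'] at h1
        apply hc (p.natDegree - i) (by omega)
        have h2 : c ^ p.natDegree = c ^ i * c ^ (p.natDegree - i) := by
          rw [← pow_add]; congr 1; omega
        rw [h2] at h1
        have h3 : c ^ i ≠ 0 := pow_ne_zero _ hc0
        field_simp at h1
        exact h1.symm
      · exact hne0 (coeff_eq_zero_of_natDegree_lt h)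
  refine ⟨p.natDegree, fun m => ?_⟩
  have h0 : aeval (φ a) p = 0 := minpoly.aeval _ _
  rw [hmon, map_pow, aeval_X, ← map_pow] at h0
  exact LinearMap.congr_fun h0 m

/-- A subspace that is stable under `T` and contains a nonzero vector annihilated by a product of
linear factors in `T` contains an eigenvector of `T`. -/
theorem exists_eigenvector_of_prod_smul_eq_zero {K A M : Type*} [Field K] [Ring A] [Algebra K A]
    [AddCommGroup M] [Module K M] [Module A M] [IsScalarTower K A M] {T : A}
    (W : Submodule K M) (hW : ∀ x ∈ W, T • x ∈ W) (s : Multiset K) :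
    ∀ h ∈ W, h ≠ 0 → aeval T (s.map fun a => X - C a).prod • h = 0 →
      ∃ w ∈ W, w ≠ 0 ∧ ∃ a ∈ s, T • w = a • w := by
  induction s using Multiset.induction_on with
  | empty => intro h _ h0 h1; simp at h1; exact absurd h1 h0
  | cons a s ih =>
    intro h hh h0 h1
    by_cases h2 : T • h = a • h
    · exact ⟨h, hh, h0, a, by simp, h2⟩
    · have h3 : T • h - a • h ≠ 0 := sub_ne_zero.mpr h2
      obtain ⟨w, hw, hw0, b, hb, hwb⟩ := ih (T • h - a • h)
        (W.sub_mem (hW h hh) (W.smul_mem _ hh)) h3 (by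
          rw [Multiset.map_cons, Multiset.prod_cons, mul_comm, map_mul, mul_smul] at h1
          simpa [sub_smul] using h1)
      exact ⟨w, hw, hw0, b, by simp [hb], hwb⟩

/-- If `T` satisfies on `h` a polynomial relation with a simple root at `a`, and `h` is a
generalized eigenvector for `a`, then `h` is an eigenvector. -/
theorem smul_eq_of_pow_sub_smul_eq_zero {K A M : Type*} [Field K] [Ring A] [Algebra K A]
    [AddCommGroup M] [Module K M] [Module A M] [IsScalarTower K A M] {T : A} {a : K} {r : K[X]}
    (hr : r.eval a ≠ 0) {h : M} (h1 : aeval T ((X - C a) * r) • h = 0) {N : ℕ}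
    (h2 : aeval T ((X - C a) ^ N) • h = 0) : T • h = a • h := by
  have hcop : IsCoprime ((X - C a) ^ N) r := by
    apply IsCoprime.pow_left
    rw [Polynomial.isCoprime_iff_aeval_ne_zero_of_isAlgClosed K (AlgebraicClosure K)]
    intro b
    by_cases hb : b = algebraMap K _ a
    · right
      rw [hb, aeval_algebraMap_apply]
      simpa using hr
    · left
      simpa [sub_eq_zero] using hb
  obtain ⟨u, w, huw⟩ := hcop
  have key : aeval T (X - C a) • h = 0 := by
    have : (X - C a) = (u * (X - C a)) * (X - C a) ^ N + w * ((X - C a) * r) := by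
      linear_combination (-(X - C a)) * huw
    rw [this, map_add, add_smul, map_mul, mul_smul, h2, map_mul _ w, mul_smul, h1, smul_zero,
      smul_zero, add_zero]
  simpa [sub_smul, sub_eq_zero] using key

namespace QuantumTriple

variable {K A : Type*} [Field K] [Ring A] [Algebra K A] {q : K} {E F T T' : A}

theorem F_T' (h : QuantumTriple q E F T T') : T' * F = q ^ 2 • (F * T') := by
  calc T' * F = T' * (F * T) * T' := by rw [mul_assoc, mul_assoc, h.T_T', mul_one]
    _ = q ^ 2 • (F * T') := by
      rw [h.F_T, mul_smul_comm, ← mul_assoc, h.T'_T, one_mul, smul_mul_assoc]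

theorem E_T' (h : QuantumTriple q E F T T') : E * T' = q ^ 2 • (T' * E) := by
  calc E * T' = T' * (T * E) * T' := by rw [← mul_assoc, h.T'_T, one_mul]
    _ = q ^ 2 • (T' * E) := by
      rw [h.T_E, mul_smul_comm, smul_mul_assoc, mul_assoc, mul_assoc, h.T_T', mul_one]

theorem T_F (h : QuantumTriple q E F T T') (hq : q ≠ 0) : T * F = q⁻¹ ^ 2 • (F * T) := by
  rw [h.F_T, smul_smul, ← mul_pow, inv_mul_cancel₀ hq, one_pow, one_smul]

theorem E_T (h : QuantumTriple q E F T T') (hq : q ≠ 0) : E * T = q⁻¹ ^ 2 • (T * E) := by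
  rw [h.T_E, smul_smul, ← mul_pow, inv_mul_cancel₀ hq, one_pow, one_smul]

/-- The commutator of `E` with a power of `F`. -/
theorem E_mul_F_pow (h : QuantumTriple q E F T T') (hq : q ≠ 0) (hq2 : q - q⁻¹ ≠ 0) (i : ℕ) :
    E * F ^ (i + 1) = F ^ (i + 1) * E +
      ((q ^ (i + 1) - q⁻¹ ^ (i + 1)) * ((q - q⁻¹) ^ 2)⁻¹) •
        (F ^ i * (q⁻¹ ^ i • T - q ^ i • T')) := by
  have hEF : E * F = F * E + (q - q⁻¹)⁻¹ • (T - T') := by rw [← h.E_F]; abel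
  induction i with
  | zero =>
    simp only [zero_add, pow_one, pow_zero, one_smul, one_mul, hEF]
    congr 2
    field_simp
  | succ i ih =>
    have e1 : (q⁻¹ ^ i • T - q ^ i • T') * F =
        F * (q⁻¹ ^ (i + 2) • T - q ^ (i + 2) • T') := by
      rw [sub_mul, smul_mul_assoc, smul_mul_assoc, h.T_F hq, h.F_T', mul_sub, mul_smul_comm,
        mul_smul_comm, smul_smul, smul_smul, ← pow_add, ← pow_add]
    rw [pow_succ F (i + 1), ← mul_assoc, ih, add_mul, mul_assoc _ E F, hEF, smul_mul_assoc,
      mul_assoc (F ^ i), e1, ← mul_assoc (F ^ i), ← pow_succ, mul_add, ← mul_assoc, add_assoc]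
    congr 1
    simp only [mul_sub, mul_smul_comm, smul_sub, smul_smul]
    have hq1 : q ^ 2 - 1 ≠ 0 := by
      have : q * (q - q⁻¹) = q ^ 2 - 1 := by field_simp
      exact this ▸ mul_ne_zero hq hq2
    match_scalars <;> simp only [inv_pow] <;> field_simp <;> ring

end QuantumTriple

/-- The monic polynomial whose roots are `± q ^ s` for `s < N`. -/
noncomputable def weightPoly {K : Type*} [Field K] (q : K) (N : ℕ) : K[X] :=
  ∏ s ∈ Finset.range N, (X ^ 2 - C (q ^ (2 * s)))

theorem weightPoly_eval {K : Type*} [Field K] (q a : K) (N : ℕ) :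
    (weightPoly q N).eval a = ∏ s ∈ Finset.range N, (a ^ 2 - q ^ (2 * s)) := by
  simp [weightPoly, eval_prod]

theorem weightPoly_eq_multiset_prod {K : Type*} [Field K] (q : K) (N : ℕ) :
    ∃ s : Multiset K, (∀ a ∈ s, ∃ n : ℕ, a ^ 2 = q ^ (2 * n)) ∧
      weightPoly q N = (s.map fun a => X - C a).prod := by
  induction N with
  | zero => exact ⟨0, by simp, by simp [weightPoly]⟩
  | succ N ih =>
    obtain ⟨s, hs, hp⟩ := ih
    refine ⟨q ^ N ::ₘ (-q ^ N) ::ₘ s, ?_, ?_⟩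
    · intro a ha
      rcases Multiset.mem_cons.mp ha with rfl | ha
      · exact ⟨N, by ring⟩
      rcases Multiset.mem_cons.mp ha with rfl | ha
      · exact ⟨N, by ring⟩
      exact hs a ha
    · rw [Multiset.map_cons, Multiset.prod_cons, Multiset.map_cons, Multiset.prod_cons, ← hp,
        weightPoly, Finset.prod_range_succ, ← weightPoly]
      simp only [C_neg, C_pow]
      ring

/-- If `q` is not a root of unity, even powers of `q` are distinct. -/
theorem pow_two_mul_injective {K : Type*} [Field K] {q : K} (hq0 : q ≠ 0)
    (hq : ∀ n : ℕ, 0 < n → q ^ n ≠ 1) {a b : ℕ} (hab : q ^ (2 * a) = q ^ (2 * b)) : a = b := by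
  wlog hlt : a ≤ b generalizing a b
  · exact (this hab.symm (by omega)).symm
  by_contra hne
  apply hq (2 * b - 2 * a) (by omega)
  have h2 : q ^ (2 * b) = q ^ (2 * a) * q ^ (2 * b - 2 * a) := by
    rw [← pow_add]; congr 1; omega
  rw [h2] at hab
  exact (mul_left_cancel₀ (pow_ne_zero _ hq0) (by rw [mul_one]; exact hab)).symm

namespace QuantumTriple

variable {K A M : Type*} [Field K] [Ring A] [Algebra K A] {q : K} {E F T T' : A}
  [AddCommGroup M] [Module K M] [Module A M] [IsScalarTower K A M]

theorem sub_inv_ne_zero (hq0 : q ≠ 0) (hq : ∀ n : ℕ, 0 < n → q ^ n ≠ 1) : q - q⁻¹ ≠ 0 := by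
  intro h0
  apply hq 2 (by norm_num)
  field_simp at h0
  linear_combination h0

/-- `smul_assoc` with the types fixed, so that rewriting does not split products of scalars. -/
theorem smul_mul_smul (c : K) (a : A) (m : M) : (c • a) • m = c • a • m :=
  smul_assoc c a m

/-- On the kernel of `E`, the operator `E ^ N * F ^ N` is a polynomial in `T`, up to a unit. -/
theorem E_pow_F_pow_smul (h : QuantumTriple q E F T T') (hq0 : q ≠ 0)
    (hq : ∀ n : ℕ, 0 < n → q ^ n ≠ 1) (N : ℕ) :
    ∃ u : K, u ≠ 0 ∧ ∀ m : M, E • m = 0 →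
      E ^ N • F ^ N • m = u • T' ^ N • aeval T (weightPoly q N) • m := by
  have hq2 := sub_inv_ne_zero hq0 hq
  induction N with
  | zero => exact ⟨1, one_ne_zero, fun m _ => by simp [weightPoly]⟩
  | succ N ih =>
    obtain ⟨u, hu, ih⟩ := ih
    refine ⟨u * ((q ^ (N + 1) - q⁻¹ ^ (N + 1)) * ((q - q⁻¹) ^ 2)⁻¹ * q⁻¹ ^ N), ?_, ?_⟩
    · refine mul_ne_zero hu (mul_ne_zero (mul_ne_zero ?_ (inv_ne_zero (pow_ne_zero _ hq2)))
        (pow_ne_zero _ (inv_ne_zero hq0)))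
      intro h0
      apply hq (2 * (N + 1)) (by omega)
      rw [sub_eq_zero, inv_pow] at h0
      rw [two_mul, pow_add]
      nth_rewrite 1 [h0]
      exact inv_mul_cancel₀ (pow_ne_zero _ hq0)
    · intro m hm
      set H : A := q⁻¹ ^ N • T - q ^ N • T' with hH
      have hEH : E • H • m = 0 := by
        rw [smul_smul, hH, mul_sub, mul_smul_comm, mul_smul_comm, h.E_T hq0, h.E_T', sub_smul]
        simp only [smul_mul_smul, mul_smul, hm, smul_zero, sub_zero]
      have hHp : H = q⁻¹ ^ N • (aeval T (X ^ 2 - C (q ^ (2 * N))) * T') := by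
        have e1 : T ^ 2 * T' = T := by rw [pow_two, mul_assoc, h.T_T', mul_one]
        simp only [map_sub, map_pow, aeval_X, aeval_C, sub_mul, e1, hH, smul_sub]
        congr 1
        rw [← map_pow, ← Algebra.smul_def, smul_smul]
        congr 1
        rw [inv_pow, two_mul, pow_add, inv_mul_cancel_left₀ (pow_ne_zero _ hq0)]
      have hcT : Commute T' T := by rw [Commute, SemiconjBy, h.T_T', h.T'_T]
      have hcp : ∀ p : K[X], T' * aeval T p = aeval T p * T' := by
        intro p
        induction p using Polynomial.induction_on' with
        | add r s hr hs => simp [hr, hs, mul_add, add_mul]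
        | monomial n b =>
          rw [aeval_monomial, ← mul_assoc, ← Algebra.commutes, mul_assoc,
            (hcT.pow_right n).eq, mul_assoc]
      have e3 : E • F ^ (N + 1) • m =
          ((q ^ (N + 1) - q⁻¹ ^ (N + 1)) * ((q - q⁻¹) ^ 2)⁻¹) • F ^ N • H • m := by
        rw [smul_smul, h.E_mul_F_pow hq0 hq2, add_smul, mul_smul, hm, smul_zero, zero_add,
          smul_mul_smul, mul_smul (F ^ N)]
      rw [pow_succ E, mul_smul, e3, smul_algebra_smul_comm, ih _ hEH]
      have e4 : T' ^ N • aeval T (weightPoly q N) • H • m =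
          q⁻¹ ^ N • T' ^ (N + 1) • aeval T (weightPoly q (N + 1)) • m := by
        have : weightPoly q (N + 1) = weightPoly q N * (X ^ 2 - C (q ^ (2 * N))) := by
          rw [weightPoly, Finset.prod_range_succ, ← weightPoly]
        rw [this, map_mul, hHp, smul_mul_smul, smul_algebra_smul_comm, smul_algebra_smul_comm, smul_smul,
          smul_smul, smul_smul, ← hcp]
        congr 2
        rw [pow_succ T', mul_assoc (T' ^ N) T', ← mul_assoc T' (aeval T (weightPoly q N)), hcp
          (weightPoly q N)]
        simp only [mul_assoc]
      rw [e4, smul_smul, smul_smul]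
      congr 1
      ring

end QuantumTriple

namespace QuantumTriple

variable {K A M : Type*} [Field K] [Ring A] [Algebra K A] {q : K} {E F T T' : A}
  [AddCommGroup M] [Module K M] [Module A M] [IsScalarTower K A M]

theorem aeval_smul_of_smul_eq {T : A} {w : M} {a : K} (hw : T • w = a • w) (p : K[X]) :
    aeval T p • w = p.eval a • w := by
  have hpow : ∀ n : ℕ, T ^ n • w = a ^ n • w := by
    intro n
    induction n with
    | zero => simp
    | succ n ih => rw [pow_succ, mul_smul, hw, smul_algebra_smul_comm, ih, smul_smul, pow_succ']
  induction p using Polynomial.induction_on' with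
  | add r s hr hs => simp [hr, hs, add_smul]
  | monomial n b =>
    rw [aeval_monomial, mul_smul, hpow, algebraMap_smul, smul_smul, eval_monomial]

theorem T'_smul (h : QuantumTriple q E F T T') {w : M} {a : K} (ha : a ≠ 0)
    (hw : T • w = a • w) : T' • w = a⁻¹ • w := by
  have : T' • T • w = w := by rw [smul_smul, h.T'_T, one_smul]
  rw [hw, smul_algebra_smul_comm] at this
  rw [eq_inv_smul_iff₀ ha, this]

theorem E_nilpotent [FiniteDimensional K M] (h : QuantumTriple q E F T T') (hq0 : q ≠ 0)
    (hq : ∀ n : ℕ, 0 < n → q ^ n ≠ 1) : ∃ N : ℕ, ∀ m : M, E ^ N • m = 0 :=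
  exists_pow_smul_eq_zero_of_mul_eq_smul_mul h.T'_T h.T_T' h.T_E (pow_ne_zero 2 hq0)
    fun n hn => by rw [← pow_mul]; exact hq _ (by omega)

theorem F_nilpotent [FiniteDimensional K M] (h : QuantumTriple q E F T T') (hq0 : q ≠ 0)
    (hq : ∀ n : ℕ, 0 < n → q ^ n ≠ 1) : ∃ N : ℕ, ∀ m : M, F ^ N • m = 0 :=
  exists_pow_smul_eq_zero_of_mul_eq_smul_mul h.T_T' h.T'_T h.F_T' (pow_ne_zero 2 hq0)
    fun n hn => by rw [← pow_mul]; exact hq _ (by omega)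

theorem T_pow_mul_T'_pow (h : QuantumTriple q E F T T') (N : ℕ) : T ^ N * T' ^ N = 1 := by
  have hc : Commute T T' := by rw [Commute, SemiconjBy, h.T_T', h.T'_T]
  rw [← hc.mul_pow, h.T_T', one_pow]

/-- On the kernel of `E` in a finite-dimensional module, `T` satisfies a separable polynomial
all of whose roots are, up to sign, powers `q ^ s` with `s ≥ 0`. -/
theorem exists_weightPoly_smul_eq_zero [FiniteDimensional K M] (h : QuantumTriple q E F T T')
    (hq0 : q ≠ 0) (hq : ∀ n : ℕ, 0 < n → q ^ n ≠ 1) :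
    ∃ N₀ : ℕ, ∀ N, N₀ ≤ N → ∀ m : M, E • m = 0 → aeval T (weightPoly q N) • m = 0 := by
  obtain ⟨N₀, hN₀⟩ := h.F_nilpotent (M := M) hq0 hq
  refine ⟨N₀, fun N hN m hm => ?_⟩
  obtain ⟨u, hu, hu'⟩ := h.E_pow_F_pow_smul (M := M) hq0 hq N
  have h1 := hu' m hm
  have h2 : F ^ N • m = 0 := by
    obtain ⟨d, rfl⟩ := Nat.exists_eq_add_of_le hN
    rw [add_comm, pow_add, mul_smul, hN₀, smul_zero]
  rw [h2, smul_zero] at h1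
  have h3 := (smul_eq_zero.mp h1.symm).resolve_left hu
  have h4 := congrArg (T ^ N • ·) h3
  simpa [smul_smul, ← mul_assoc, h.T_pow_mul_T'_pow] using h4

/-- Highest weights of finite-dimensional modules are, up to sign, powers `q ^ n` with `n ≥ 0`. -/
theorem exists_sq_eq [FiniteDimensional K M] (h : QuantumTriple q E F T T')
    (hq0 : q ≠ 0) (hq : ∀ n : ℕ, 0 < n → q ^ n ≠ 1) {w : M} (hw : w ≠ 0) (hE : E • w = 0)
    {a : K} (hT : T • w = a • w) : ∃ n : ℕ, a ^ 2 = q ^ (2 * n) := by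
  obtain ⟨N, hN⟩ := h.exists_weightPoly_smul_eq_zero (M := M) hq0 hq
  have h1 := hN N le_rfl w hE
  rw [aeval_smul_of_smul_eq hT, smul_eq_zero, or_iff_left hw, weightPoly_eval,
    Finset.prod_eq_zero_iff] at h1
  obtain ⟨s, -, hs⟩ := h1
  exact ⟨s, sub_eq_zero.mp hs⟩

/-- On the kernel of `E`, generalized eigenvectors of `T` are eigenvectors. -/
theorem smul_eq_of_generalized [CharZero K] [FiniteDimensional K M]
    (h : QuantumTriple q E F T T') (hq0 : q ≠ 0) (hq : ∀ n : ℕ, 0 < n → q ^ n ≠ 1) {w : M}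
    (hE : E • w = 0) {a : K} {n : ℕ} (ha : a ^ 2 = q ^ (2 * n)) {r : ℕ}
    (hT : aeval T ((X - C a) ^ r) • w = 0) : T • w = a • w := by
  obtain ⟨N₀, hN₀⟩ := h.exists_weightPoly_smul_eq_zero (M := M) hq0 hq
  set N := N₀ + n + 1
  have h1 := hN₀ N (by omega) w hE
  have ha0 : a ≠ 0 := by
    rintro rfl
    exact pow_ne_zero (2 * n) hq0 (by rw [← ha]; simp)
  have hp : weightPoly q N =
      (X - C a) * ((X + C a) * ∏ s ∈ (Finset.range N).erase n, (X ^ 2 - C (q ^ (2 * s)))) := by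
    rw [weightPoly, ← Finset.mul_prod_erase _ _ (Finset.mem_range.mpr (by omega : n < N)), ← ha,
      C_pow]
    ring
  rw [hp] at h1
  refine smul_eq_of_pow_sub_smul_eq_zero ?_ h1 hT
  rw [eval_mul, eval_prod]
  refine mul_ne_zero ?_ (Finset.prod_ne_zero_iff.mpr fun s hs => ?_)
  · rw [eval_add, eval_X, eval_C, ← two_mul]
    exact mul_ne_zero two_ne_zero ha0
  · rw [eval_sub, eval_pow, eval_X, eval_C, ha]
    intro h0
    exact (Finset.mem_erase.mp hs).1 (pow_two_mul_injective hq0 hq (sub_eq_zero.mp h0)).symm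

/-- A nonzero subspace stable under `E` and `T` contains a highest weight vector. -/
theorem exists_highest_weight_vector [FiniteDimensional K M] (h : QuantumTriple q E F T T')
    (hq0 : q ≠ 0) (hq : ∀ n : ℕ, 0 < n → q ^ n ≠ 1) (W : Submodule K M)
    (hWE : ∀ x ∈ W, E • x ∈ W) (hWT : ∀ x ∈ W, T • x ∈ W) {x : M} (hx : x ∈ W) (hx0 : x ≠ 0) :
    ∃ w ∈ W, w ≠ 0 ∧ E • w = 0 ∧ ∃ (a : K) (n : ℕ), a ^ 2 = q ^ (2 * n) ∧ T • w = a • w := by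
  obtain ⟨N, hN⟩ := h.E_nilpotent (M := M) hq0 hq
  classical
  have hex : ∃ j, E ^ j • x = 0 := ⟨N, hN x⟩
  have hfind := Nat.find_spec hex
  obtain ⟨j, hj⟩ : ∃ j, Nat.find hex = j + 1 := by
    refine Nat.exists_eq_succ_of_ne_zero fun h0 => hx0 ?_
    simpa [h0] using hfind
  have hjne : E ^ j • x ≠ 0 := Nat.find_min hex (by omega)
  have hEj : E • E ^ j • x = 0 := by rw [smul_smul, ← pow_succ', ← hj]; exact hfind
  have hmem : ∀ i, E ^ i • x ∈ W := by
    intro i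
    induction i with
    | zero => simpa
    | succ i ih => rw [pow_succ', mul_smul]; exact hWE _ ih
  obtain ⟨N₀, hN₀⟩ := h.exists_weightPoly_smul_eq_zero (M := M) hq0 hq
  obtain ⟨s, hs, hp⟩ := weightPoly_eq_multiset_prod q N₀
  have h1 := hN₀ N₀ le_rfl _ hEj
  rw [hp] at h1
  let W' : Submodule K M := W ⊓ LinearMap.ker (Algebra.lsmul K K M E)
  have hW' : ∀ y, y ∈ W' ↔ y ∈ W ∧ E • y = 0 := fun y => Iff.rfl
  obtain ⟨w, hw, hw0, a, ha, hTa⟩ := exists_eigenvector_of_prod_smul_eq_zero W'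
    (fun y hy => ⟨hWT _ hy.1, ((hW' _).mpr ⟨hWT _ hy.1, by
      rw [smul_smul, h.E_T hq0, smul_mul_smul, mul_smul, ((hW' _).mp hy).2, smul_zero, smul_zero]⟩).2⟩)
    s _ ((hW' _).mpr ⟨hmem j, hEj⟩) hjne h1
  obtain ⟨n, hn⟩ := hs a ha
  exact ⟨w, hw.1, hw0, hw.2, a, n, hn, hTa⟩

/-- The weight of `F ^ i • w` is the weight of `w` times `q ^ (-2 i)`. -/
theorem T_smul_F_pow (h : QuantumTriple q E F T T') (hq0 : q ≠ 0) {w : M} {a : K}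
    (hT : T • w = a • w) (i : ℕ) : T • F ^ i • w = (q⁻¹ ^ (2 * i) * a) • F ^ i • w := by
  induction i with
  | zero => simpa
  | succ i ih =>
    rw [pow_succ', mul_smul, smul_smul, h.T_F hq0, smul_mul_smul, mul_smul, ih, smul_algebra_smul_comm,
      smul_smul]
    congr 1
    ring

theorem E_smul_F_pow_succ (h : QuantumTriple q E F T T') (hq0 : q ≠ 0)
    (hq : ∀ n : ℕ, 0 < n → q ^ n ≠ 1) {w : M} (hE : E • w = 0) {a : K} (ha : a ≠ 0)
    (hT : T • w = a • w) (i : ℕ) : ∃ c : K, E • F ^ (i + 1) • w = c • F ^ i • w := by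
  rw [smul_smul, h.E_mul_F_pow hq0 (sub_inv_ne_zero hq0 hq), add_smul, mul_smul, hE, smul_zero,
    zero_add, smul_mul_smul, mul_smul (F ^ _), sub_smul, smul_mul_smul, smul_mul_smul, hT, h.T'_smul ha hT,
    smul_smul, smul_smul, ← sub_smul, smul_algebra_smul_comm, smul_smul]
  exact ⟨_, rfl⟩

/-- If `w` is a highest weight vector of weight `± q ^ n`, then `E ^ j` maps `F ^ j • w` to a
nonzero multiple of `w` for `j ≤ n`. -/
theorem E_pow_smul_F_pow (h : QuantumTriple q E F T T') (hq0 : q ≠ 0)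
    (hq : ∀ n : ℕ, 0 < n → q ^ n ≠ 1) {w : M} (hE : E • w = 0) {a : K} {n : ℕ}
    (ha : a ^ 2 = q ^ (2 * n)) (hT : T • w = a • w) {j : ℕ} (hj : j ≤ n) :
    ∃ c : K, c ≠ 0 ∧ E ^ j • F ^ j • w = c • w := by
  have ha0 : a ≠ 0 := by
    rintro rfl
    exact pow_ne_zero (2 * n) hq0 (by rw [← ha]; simp)
  obtain ⟨u, hu, hu'⟩ := h.E_pow_F_pow_smul (M := M) hq0 hq j
  have hT' : ∀ i : ℕ, T' ^ i • w = (a⁻¹) ^ i • w := by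
    intro i
    induction i with
    | zero => simp
    | succ i ih => rw [pow_succ, mul_smul, h.T'_smul ha0 hT, smul_algebra_smul_comm, ih, smul_smul,
        pow_succ']
  refine ⟨u * (((weightPoly q j).eval a) * a⁻¹ ^ j), ?_, ?_⟩
  · refine mul_ne_zero hu (mul_ne_zero ?_ (pow_ne_zero _ (inv_ne_zero ha0)))
    rw [weightPoly_eval, ha]
    refine Finset.prod_ne_zero_iff.mpr fun s hs h0 => ?_
    have := pow_two_mul_injective hq0 hq (sub_eq_zero.mp h0)
    have := Finset.mem_range.mp hs
    omega
  · rw [hu' w hE, aeval_smul_of_smul_eq hT, smul_algebra_smul_comm, hT', smul_smul, smul_smul, mul_assoc]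

theorem E_pow_smul_F_pow_of_lt (h : QuantumTriple q E F T T') (hq0 : q ≠ 0)
    (hq : ∀ n : ℕ, 0 < n → q ^ n ≠ 1) {w : M} (hE : E • w = 0) {a : K} (ha : a ≠ 0)
    (hT : T • w = a • w) (i : ℕ) : ∀ j, i < j → E ^ j • F ^ i • w = 0 := by
  induction i with
  | zero =>
    intro j hj
    obtain ⟨k, rfl⟩ := Nat.exists_eq_succ_of_ne_zero hj.ne'
    rw [pow_zero, one_smul, pow_succ, mul_smul, hE, smul_zero]
  | succ i ih =>
    intro j hj
    obtain ⟨k, rfl⟩ := Nat.exists_eq_succ_of_ne_zero (Nat.ne_zero_of_lt hj)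
    obtain ⟨c, hc⟩ := h.E_smul_F_pow_succ hq0 hq hE ha hT i
    rw [pow_succ E, mul_smul, hc, smul_algebra_smul_comm, ih k (by omega), smul_zero]

/-- The string `w, F • w, F ^ 2 • w, …` through a highest weight vector of weight `± q ^ n` stops
after `n + 1` terms: the next term would be a highest weight vector of weight
`± q ^ (-n - 2)`. -/
theorem F_pow_succ_smul_eq_zero [FiniteDimensional K M] (h : QuantumTriple q E F T T')
    (hq0 : q ≠ 0) (hq : ∀ n : ℕ, 0 < n → q ^ n ≠ 1) {w : M} (hE : E • w = 0) {a : K} {n : ℕ}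
    (ha : a ^ 2 = q ^ (2 * n)) (hT : T • w = a • w) : F ^ (n + 1) • w = 0 := by
  have ha0 : a ≠ 0 := by
    rintro rfl
    exact pow_ne_zero (2 * n) hq0 (by rw [← ha]; simp)
  by_contra hne
  have hE' : E • F ^ (n + 1) • w = 0 := by
    rw [smul_smul, h.E_mul_F_pow hq0 (sub_inv_ne_zero hq0 hq), add_smul, mul_smul, hE, smul_zero,
      zero_add, smul_mul_smul, mul_smul (F ^ _), sub_smul, smul_mul_smul, smul_mul_smul, hT, h.T'_smul ha0 hT,
      smul_smul, smul_smul, ← sub_smul]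
    have : q⁻¹ ^ n * a - q ^ n * a⁻¹ = 0 := by
      rw [inv_pow]
      have hqn := pow_ne_zero n hq0
      field_simp
      rw [ha]
      ring
    rw [this, zero_smul, smul_zero, smul_zero]
  obtain ⟨m, hm⟩ := h.exists_sq_eq hq0 hq hne hE' (h.T_smul_F_pow hq0 hT (n + 1))
  apply hq (2 * (n + 2 + m)) (by omega)
  rw [mul_pow, ha, inv_pow, inv_pow, ← pow_mul] at hm
  have hqn := pow_ne_zero (2 * (n + 1) * 2) hq0
  field_simp at hm
  have h2 : q ^ (2 * n) * 1 = q ^ (2 * n) * q ^ (2 * (n + 2 + m)) := by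
    rw [mul_one, ← pow_add]
    refine hm.trans ?_
    rw [← pow_add]
    congr 1
    ring
  exact (mul_left_cancel₀ (pow_ne_zero _ hq0) h2).symm

/-- Every nonzero vector in the string through a highest weight vector `w` is moved to a nonzero
multiple of `w` by some power of `E`. -/
theorem exists_E_pow_smul_eq [FiniteDimensional K M] (h : QuantumTriple q E F T T')
    (hq0 : q ≠ 0) (hq : ∀ n : ℕ, 0 < n → q ^ n ≠ 1) {w : M} (hE : E • w = 0) {a : K} {n : ℕ}
    (ha : a ^ 2 = q ^ (2 * n)) (hT : T • w = a • w) {x : M}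
    (hx : x ∈ Submodule.span K (Set.range fun i : ℕ => F ^ i • w)) (hx0 : x ≠ 0) :
    ∃ (j : ℕ) (c : K), c ≠ 0 ∧ E ^ j • x = c • w := by
  have ha0 : a ≠ 0 := by
    rintro rfl
    exact pow_ne_zero (2 * n) hq0 (by rw [← ha]; simp)
  have hF := h.F_pow_succ_smul_eq_zero hq0 hq hE ha hT
  have hsum : ∃ b : ℕ → K, x = ∑ i ∈ Finset.range (n + 1), b i • F ^ i • w := by
    induction hx using Submodule.span_induction with
    | mem y hy =>
      obtain ⟨i, rfl⟩ := hy
      by_cases hi : i < n + 1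
      · refine ⟨fun k => if k = i then 1 else 0, ?_⟩
        simp [ite_smul, hi]
      · obtain ⟨d, rfl⟩ := Nat.exists_eq_add_of_le (not_lt.mp hi)
        exact ⟨0, by simp [add_comm (n + 1) d, pow_add _ d, mul_smul, hF]⟩
    | zero => exact ⟨0, by simp⟩
    | add y z _ _ hy hz =>
      by_cases hy0 : y = 0
      · subst hy0
        simp only [zero_add] at hx0 ⊢
        exact hz hx0
      by_cases hz0 : z = 0
      · subst hz0
        simp only [add_zero] at hx0 ⊢
        exact hy hx0
      obtain ⟨b, hb⟩ := hy hy0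
      obtain ⟨b', hb'⟩ := hz hz0
      exact ⟨b + b', by simp [hb, hb', add_smul, Finset.sum_add_distrib]⟩
    | smul c y _ hy =>
      by_cases hy0 : y = 0
      · exact absurd (by simp [hy0]) hx0
      obtain ⟨b, hb⟩ := hy hy0
      exact ⟨c • b, by simp [hb, Finset.smul_sum, mul_smul]⟩
  obtain ⟨b, hb⟩ := hsum
  -- the last index with a nonzero coefficient determines the power of `E`
  have main : ∀ N, N ≤ n + 1 → ∑ i ∈ Finset.range N, b i • F ^ i • w ≠ 0 →
      ∃ (j : ℕ) (c : K), c ≠ 0 ∧ E ^ j • ∑ i ∈ Finset.range N, b i • F ^ i • w = c • w := by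
    intro N
    induction N with
    | zero => intro _ h0; simp at h0
    | succ N ih =>
      intro hN h0
      by_cases hbN : b N = 0
      · simp only [Finset.sum_range_succ, hbN, zero_smul, add_zero] at h0 ⊢
        exact ih (by omega) h0
      · obtain ⟨c, hc, hc'⟩ := h.E_pow_smul_F_pow hq0 hq hE ha hT (by omega : N ≤ n)
        refine ⟨N, b N * c, mul_ne_zero hbN hc, ?_⟩
        rw [Finset.sum_range_succ, smul_add, Finset.smul_sum, Finset.sum_eq_zero, zero_add,
          smul_algebra_smul_comm, hc', smul_smul]
        intro i hi
        rw [smul_algebra_smul_comm, h.E_pow_smul_F_pow_of_lt hq0 hq hE ha0 hT i N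
          (Finset.mem_range.mp hi), smul_zero]
  rw [hb] at hx0 ⊢
  exact main _ le_rfl hx0

/-- The span of the string through a highest weight vector is stable under the quantum triple. -/
theorem string_stable (h : QuantumTriple q E F T T') (hq0 : q ≠ 0)
    (hq : ∀ n : ℕ, 0 < n → q ^ n ≠ 1) {w : M} (hE : E • w = 0) {a : K} (ha : a ≠ 0)
    (hT : T • w = a • w) {x : M}
    (hx : x ∈ Submodule.span K (Set.range fun i : ℕ => F ^ i • w)) :
    ∀ g ∈ ({E, F, T, T'} : Set A),
      g • x ∈ Submodule.span K (Set.range fun i : ℕ => F ^ i • w) := by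
  intro g hg
  induction hx using Submodule.span_induction with
  | zero => simp
  | add y z _ _ hy hz => rw [smul_add]; exact Submodule.add_mem _ hy hz
  | smul c y _ hy => rw [smul_algebra_smul_comm]; exact Submodule.smul_mem _ _ hy
  | mem y hy =>
    obtain ⟨i, rfl⟩ := hy
    have hmem : ∀ i : ℕ, F ^ i • w ∈ Submodule.span K (Set.range fun i : ℕ => F ^ i • w) :=
      fun i => Submodule.subset_span ⟨i, rfl⟩
    have hTi := h.T_smul_F_pow hq0 hT i
    simp only [Set.mem_insert_iff, Set.mem_singleton_iff] at hg
    rcases hg with rfl | rfl | rfl | rfl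
    · cases i with
      | zero => simp [hE]
      | succ i =>
        obtain ⟨c, hc⟩ := h.E_smul_F_pow_succ hq0 hq hE ha hT i
        simp only [hc]
        exact Submodule.smul_mem _ _ (hmem i)
    · rw [smul_smul, ← pow_succ']
      exact hmem (i + 1)
    · simp only [hTi]
      exact Submodule.smul_mem _ _ (hmem i)
    · simp only [h.T'_smul (mul_ne_zero (pow_ne_zero _ (inv_ne_zero hq0)) ha) hTi]
      exact Submodule.smul_mem _ _ (hmem i)

/-- `E` multiplies generalized weights by `q ^ 2`. -/
theorem aeval_smul_E_smul (h : QuantumTriple q E F T T') {a : K} {r : ℕ} {x : M}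
    (hx : aeval T ((X - C a) ^ r) • x = 0) :
    aeval T ((X - C (q ^ 2 * a)) ^ r) • E • x = 0 := by
  have h1 : aeval T (X - C (q ^ 2 * a)) * E = q ^ 2 • (E * aeval T (X - C a)) := by
    simp only [map_sub, aeval_X, aeval_C, sub_mul, mul_sub, smul_sub, h.T_E]
    rw [map_mul, ← Algebra.commutes a E, Algebra.smul_def (q ^ 2)
      (algebraMap K A a * E)]
    simp [mul_assoc]
  have h2 : ∀ r, aeval T ((X - C (q ^ 2 * a)) ^ r) * E =
      (q ^ 2) ^ r • (E * aeval T ((X - C a) ^ r)) := by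
    intro r
    induction r with
    | zero => simp
    | succ r ih =>
      rw [pow_succ' (X - C (q ^ 2 * a)), map_mul, mul_assoc, ih, mul_smul_comm, ← mul_assoc, h1,
        pow_succ' (X - C a), map_mul, smul_mul_assoc, smul_smul, ← pow_succ, mul_assoc]
  rw [smul_smul, h2, smul_mul_smul, mul_smul, hx, smul_zero, smul_zero]

/-- In a finite-dimensional module, `E` maps the generalized weight space of a dominant weight
`a` onto that of `q ^ 2 * a`, inside any subspace stable under the triple. -/
theorem exists_E_smul_eq [CharZero K] [FiniteDimensional K M] (h : QuantumTriple q E F T T')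
    (hq0 : q ≠ 0) (hq : ∀ n : ℕ, 0 < n → q ^ n ≠ 1) (W : Submodule K M)
    (hWE : ∀ x ∈ W, E • x ∈ W) (hWF : ∀ x ∈ W, F • x ∈ W) {a : K} {n : ℕ}
    (ha : a ^ 2 = q ^ (2 * n)) {r : ℕ} {u : M} (hu : u ∈ W)
    (hTu : aeval T ((X - C (q ^ 2 * a)) ^ (r + 1)) • u = 0) :
    ∃ y ∈ W, E • y = u ∧ aeval T ((X - C a) ^ (r + 1)) • y = 0 := by
  have hpow : ∀ G : A, (∀ x ∈ W, G • x ∈ W) → ∀ i : ℕ, ∀ x ∈ W, G ^ i • x ∈ W := by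
    intro G hG i
    induction i with
    | zero => intro x hx; simpa
    | succ i ih => intro x hx; rw [pow_succ', mul_smul]; exact hG _ (ih x hx)
  obtain ⟨N, hN⟩ := h.E_nilpotent (M := M) hq0 hq
  have main : ∀ j : ℕ, ∀ u ∈ W, aeval T ((X - C (q ^ 2 * a)) ^ (r + 1)) • u = 0 →
      E ^ j • u = 0 → ∃ y ∈ W, E • y = u ∧ aeval T ((X - C a) ^ (r + 1)) • y = 0 := by
    intro j
    induction j with
    | zero =>
      intro u _ _ h0
      rw [pow_zero, one_smul] at h0
      exact ⟨0, W.zero_mem, by simp [h0], by simp⟩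
    | succ j ih =>
      intro u hu hTu h0
      -- `v₀ = E ^ j • u` is a highest weight vector of weight `q ^ (2 * (j + 1)) * a`
      set v₀ := E ^ j • u with hv₀
      have hEv : E • v₀ = 0 := by rw [hv₀, smul_smul, ← pow_succ', h0]
      have hgen : ∀ i : ℕ, aeval T ((X - C (q ^ (2 * (i + 1)) * a)) ^ (r + 1)) • E ^ i • u = 0 := by
        intro i
        induction i with
        | zero => simpa using hTu
        | succ i ih =>
          have := h.aeval_smul_E_smul ih
          rw [smul_smul E, ← pow_succ', ← mul_assoc, ← pow_add] at this
          convert this using 7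
          ring
      have hb : (q ^ (2 * (j + 1)) * a) ^ 2 = q ^ (2 * (n + 2 * (j + 1))) := by
        rw [mul_pow, ha, ← pow_mul, ← pow_add]; congr 1; ring
      have hTv := h.smul_eq_of_generalized hq0 hq hEv hb (hgen j)
      obtain ⟨c, hc, hc'⟩ := h.E_pow_smul_F_pow hq0 hq hEv hb hTv (by omega : j + 1 ≤ _)
      set y₁ := c⁻¹ • F ^ (j + 1) • v₀ with hy₁
      have hTy : T • y₁ = a • y₁ := by
        rw [hy₁, smul_algebra_smul_comm, h.T_smul_F_pow hq0 hTv, ← mul_assoc, inv_pow,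
          inv_mul_cancel₀ (pow_ne_zero _ hq0), one_mul, smul_comm]
      have hy₁W : y₁ ∈ W := W.smul_mem _ (hpow F hWF _ _ (hpow E hWE _ _ hu))
      have hy₁T : aeval T ((X - C a) ^ (r + 1)) • y₁ = 0 := by
        rw [aeval_smul_of_smul_eq hTy]; simp
      obtain ⟨y₂, hy₂W, hEy₂, hy₂T⟩ := ih (u - E • y₁) (W.sub_mem hu (hWE _ hy₁W)) (by
        rw [smul_sub, hTu, h.aeval_smul_E_smul hy₁T, sub_zero]) (by
        rw [smul_sub, smul_smul _ E, ← pow_succ, hy₁, smul_algebra_smul_comm, hc', smul_smul,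
          inv_mul_cancel₀ hc, one_smul, sub_self])
      refine ⟨y₁ + y₂, W.add_mem hy₁W hy₂W, ?_, ?_⟩
      · rw [smul_add, hEy₂]; abel
      · rw [smul_add, hy₁T, hy₂T, add_zero]
  exact main N u hu hTu (hN u)

end QuantumTriple

/-! ### From the mirabolic relations to a quantum triple and matrix units -/

/-- The defining relations of mirabolic quantum `sl₂` at the parameter `q`, for elements of an
arbitrary algebra. -/
structure MirabolicRelations {K A : Type*} [Field K] [Ring A] [Algebra K A]
    (q : K) (e f k k' l : A) : Prop where
  k_k' : k * k' = 1
  k'_k : k' * k = 1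
  k_e : k * e * k' = q ^ 2 • e
  k_f : k * f * k' = q⁻¹ ^ 2 • f
  e_f : e * f - f * e = (q - q⁻¹)⁻¹ • (k - k')
  l_l : l * l = l
  k_l : k * l = l * k
  l_e_l : l * e * l = l * e
  l_f_l : l * f * l = f * l
  e_l_e : (q + q⁻¹) • (e * l * e) = q⁻¹ • (e * e * l) + q • (l * e * e)
  f_l_f : (q + q⁻¹) • (f * l * f) = q⁻¹ • (l * f * f) + q • (f * f * l)

/-- The mirabolic relations in block form with respect to the idempotent `l`: the generators are
`e = E + x` and `f = G + y`, where `E` and `G` commute with `l` and `x`, `y` are the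
off-diagonal blocks. -/
structure BlockRelations {K A : Type*} [Field K] [Ring A] [Algebra K A]
    (q : K) (E G k k' l x y : A) : Prop where
  k_k' : k * k' = 1
  k'_k : k' * k = 1
  k_E : k * E = q ^ 2 • (E * k)
  G_k : G * k = q ^ 2 • (k * G)
  k_x : k * x = q ^ 2 • (x * k)
  y_k : y * k = q ^ 2 • (k * y)
  E_G : E * G - G * E = (q - q⁻¹)⁻¹ • (k - k') - x * y + y * x
  l_l : l * l = l
  l_E : l * E = E * l
  l_G : l * G = G * l
  l_k : l * k = k * l
  l_x : l * x = 0
  x_l : x * l = x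
  l_y : l * y = y
  y_l : y * l = 0
  x_G : x * G = G * x
  y_E : y * E = E * y
  E_x : E * x = q ^ 2 • (x * E)
  y_G : y * G = q ^ 2 • (G * y)

section assoc

variable {K A : Type*} [Field K] [Ring A] [Algebra K A] {a b c d : A} {s : K}

theorem mul_mul_eq_of_mul_eq_mul (h : a * b = c * d) (z : A) : a * (b * z) = c * (d * z) := by
  rw [← mul_assoc, h, mul_assoc]

theorem mul_mul_eq_of_mul_eq (h : a * b = c) (z : A) : a * (b * z) = c * z := by
  rw [← mul_assoc, h]

theorem mul_mul_eq_zero_of_mul_eq_zero (h : a * b = 0) (z : A) : a * (b * z) = 0 := by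
  rw [← mul_assoc, h, zero_mul]

theorem mul_mul_eq_of_mul_eq_one (h : a * b = 1) (z : A) : a * (b * z) = z := by
  rw [← mul_assoc, h, one_mul]

theorem mul_mul_eq_of_mul_eq_smul (h : a * b = s • (c * d)) (z : A) :
    a * (b * z) = s • (c * (d * z)) := by
  rw [← mul_assoc, h, smul_mul_assoc, mul_assoc]

end assoc

namespace MirabolicRelations

variable {K A : Type*} [Field K] [Ring A] [Algebra K A] {q : K} {e f k k' l : A}

theorem blockRelations (h : MirabolicRelations q e f k k' l) (hq0 : q ≠ 0) :
    BlockRelations q (e - (e * l - l * e)) (f - (l * f - f * l)) k k' l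
      (e * l - l * e) (l * f - f * l) := by
  have hle : l * (e * l) = l * e := by rw [← mul_assoc, h.l_e_l]
  have hlf : l * (f * l) = f * l := by rw [← mul_assoc, h.l_f_l]
  have hll' := mul_mul_eq_of_mul_eq h.l_l
  obtain ⟨x, hx⟩ : ∃ x, x = e * l - l * e := ⟨_, rfl⟩
  obtain ⟨y, hy⟩ : ∃ y, y = l * f - f * l := ⟨_, rfl⟩
  obtain ⟨E, hE⟩ : ∃ E, E = e - (e * l - l * e) := ⟨_, rfl⟩
  obtain ⟨G, hG⟩ : ∃ G, G = f - (l * f - f * l) := ⟨_, rfl⟩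
  have he : e = E + x := by rw [hE, hx]; abel
  have hf : f = G + y := by rw [hG, hy]; abel
  have hke : k * e = q ^ 2 • (e * k) := by
    rw [← smul_mul_assoc, ← h.k_e, mul_assoc _ k', h.k'_k, mul_one]
  have hfk : f * k = q ^ 2 • (k * f) := by
    have : k * f = q⁻¹ ^ 2 • (f * k) := by
      rw [← smul_mul_assoc, ← h.k_f, mul_assoc _ k', h.k'_k, mul_one]
    rw [this, smul_smul, ← mul_pow, mul_inv_cancel₀ hq0, one_pow, one_smul]
  have hke' := mul_mul_eq_of_mul_eq_smul hke
  have hfk' := mul_mul_eq_of_mul_eq_smul hfk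
  have hkl' := mul_mul_eq_of_mul_eq_mul h.k_l
  have hlk' := mul_mul_eq_of_mul_eq_mul h.k_l.symm
  have lx : l * x = 0 := by rw [hx, mul_sub, hle, hll', sub_self]
  have xl : x * l = x := by rw [hx, sub_mul, mul_assoc, mul_assoc, hle, h.l_l]
  have ly : l * y = y := by rw [hy, mul_sub, hll', hlf]
  have yl : y * l = 0 := by rw [hy, sub_mul, mul_assoc, mul_assoc, hlf, h.l_l, sub_self]
  have lE : l * E = E * l := by
    simp only [hE, mul_sub, sub_mul, mul_assoc, hle, h.l_l, hll']; abel
  have lG : l * G = G * l := by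
    simp only [hG, mul_sub, sub_mul, mul_assoc, hlf, h.l_l, hll']; abel
  have kx : k * x = q ^ 2 • (x * k) := by
    rw [hx, mul_sub, sub_mul, hke', hkl', hke, mul_assoc, mul_assoc, ← h.k_l, mul_smul_comm,
      smul_sub]
  have yk : y * k = q ^ 2 • (k * y) := by
    rw [hy, mul_sub, sub_mul, mul_assoc, mul_assoc, hfk, ← h.k_l, hfk', mul_smul_comm, hlk',
      smul_sub]
  have kE : k * E = q ^ 2 • (E * k) := by rw [hE, ← hx, mul_sub, sub_mul, hke, kx, smul_sub]
  have Gk : G * k = q ^ 2 • (k * G) := by rw [hG, ← hy, mul_sub, sub_mul, hfk, yk, smul_sub]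
  have lx' := mul_mul_eq_zero_of_mul_eq_zero lx
  have yl' := mul_mul_eq_zero_of_mul_eq_zero yl
  have xl' := mul_mul_eq_of_mul_eq xl
  have ly' := mul_mul_eq_of_mul_eq ly
  have lE' := mul_mul_eq_of_mul_eq_mul lE
  have lG' := mul_mul_eq_of_mul_eq_mul lG
  have xGl : x * (G * l) = x * G := by rw [← lG, xl']
  have xEl : x * (E * l) = x * E := by rw [← lE, xl']
  have yEl : y * (E * l) = 0 := by rw [← lE, yl']
  have yGl : y * (G * l) = 0 := by rw [← lG, yl']
  have hk'l : k' * l = l * k' := by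
    calc k' * l = k' * (l * k) * k' := by rw [mul_assoc, mul_assoc, h.k_k', mul_one]
      _ = l * k' := by rw [← h.k_l, ← mul_assoc, h.k'_k, one_mul]
  have xx : x * x = 0 := by
    nth_rewrite 1 [← xl]
    rw [mul_assoc, lx, mul_zero]
  have yy : y * y = 0 := by
    nth_rewrite 2 [← ly]
    exact yl' y
  have H := h.e_f
  rw [he, hf] at H
  -- the blocks of the commutator relation
  have xG : x * G = G * x := by
    have := congrArg (fun z => z * l - l * (z * l)) H
    simp only [add_mul, mul_add, sub_mul, mul_sub, smul_mul_assoc, mul_smul_comm, mul_assoc, lx,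
      xl, yl, lx', ly', lE', lG', hk'l, hlk', h.l_l, hll', xGl, yEl, mul_zero, smul_sub] at this
    rw [← sub_eq_zero, ← sub_eq_zero.mpr this]
    abel
  have yE : y * E = E * y := by
    have := congrArg (fun z => l * z - l * (z * l)) H
    simp only [add_mul, mul_add, sub_mul, mul_sub, smul_mul_assoc, mul_smul_comm, mul_assoc, lx,
      xl, ly, yl, lE, lG, lx', ly', lE', lG', ← h.k_l, hk'l, hlk', h.l_l, hll', xGl, yEl,
      mul_zero, smul_sub] at this
    rw [← sub_eq_zero, ← sub_eq_zero.mpr this.symm]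
    abel
  have EG : E * G - G * E = (q - q⁻¹)⁻¹ • (k - k') - x * y + y * x := by
    rw [← H]
    simp only [add_mul, mul_add, xG, yE]
    abel
  have Ex : E * x = q ^ 2 • (x * E) := by
    have := h.e_l_e
    rw [he] at this
    simp only [add_mul, mul_add, mul_assoc, lx, xl, lE, xEl, mul_zero, zero_mul, xx] at this
    have h2 : q • (x * E) = q⁻¹ • (E * x) := by
      rw [← sub_eq_zero] at this ⊢
      rw [← this]
      module
    have h3 := congrArg (fun z => q • z) h2
    simp only [smul_smul, mul_inv_cancel₀ hq0, one_smul] at h3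
    rw [← h3, pow_two]
  have yG : y * G = q ^ 2 • (G * y) := by
    have := h.f_l_f
    rw [hf] at this
    simp only [add_mul, mul_add, mul_assoc, ly, yl, lG, yGl, mul_zero, zero_mul, yy] at this
    have h2 : q • (G * y) = q⁻¹ • (y * G) := by
      rw [← sub_eq_zero] at this ⊢
      rw [← this]
      module
    have h3 := congrArg (fun z => q • z) h2
    simp only [smul_smul, mul_inv_cancel₀ hq0, one_smul] at h3
    rw [← h3, pow_two]
  rw [← hE, ← hG, ← hx, ← hy]
  exact ⟨h.k_k', h.k'_k, kE, Gk, kx, yk, EG, h.l_l, lE, lG, h.k_l.symm, lx, xl, ly, yl, xG, yE,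
    Ex, yG⟩

end MirabolicRelations

/-- A quantum triple `E, F, T, T⁻¹` together with commuting idempotents `P`, `l` and matrix units
`X`, `Y` that all commute with the triple: `P * (1 - l)`, `X`, `Y` and `P * l` are `2 × 2` matrix
units, while `(1 - P) * l` and `(1 - P) * (1 - l)` are central. -/
structure MatrixTriple {K A : Type*} [Field K] [Ring A] [Algebra K A]
    (q : K) (E F T T' P l X Y : A) : Prop extends QuantumTriple q E F T T' where
  P_E : Commute P E
  P_F : Commute P F
  P_T : Commute P T
  l_E : Commute l E
  l_F : Commute l F
  l_T : Commute l T
  X_E : Commute X E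
  X_F : Commute X F
  X_T : Commute X T
  Y_E : Commute Y E
  Y_F : Commute Y F
  Y_T : Commute Y T
  P_P : P * P = P
  l_l : l * l = l
  P_l : Commute P l
  X_Y : X * Y = P - P * l
  Y_X : Y * X = P * l
  P_X : P * X = X
  X_P : X * P = X
  P_Y : P * Y = Y
  Y_P : Y * P = Y
  l_X : l * X = 0
  X_l : X * l = X
  l_Y : l * Y = Y
  Y_l : Y * l = 0

namespace BlockRelations

variable {K A : Type*} [Field K] [Ring A] [Algebra K A] {q : K} {E G k k' l x y : A}

theorem x_k' (h : BlockRelations q E G k k' l x y) : x * k' = q ^ 2 • (k' * x) := by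
  calc x * k' = k' * (k * x) * k' := by rw [← mul_assoc, h.k'_k, one_mul]
    _ = _ := by
      rw [h.k_x, mul_smul_comm, smul_mul_assoc, mul_assoc, mul_assoc, h.k_k', mul_one]

theorem k'_y (h : BlockRelations q E G k k' l x y) : k' * y = q ^ 2 • (y * k') := by
  calc k' * y = k' * (y * k) * k' := by rw [mul_assoc, mul_assoc, h.k_k', mul_one]
    _ = _ := by
      rw [h.y_k, mul_smul_comm, smul_mul_assoc, ← mul_assoc, h.k'_k, one_mul]

theorem x_x (h : BlockRelations q E G k k' l x y) : x * x = 0 := by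
  nth_rewrite 1 [← h.x_l]
  rw [mul_assoc, h.l_x, mul_zero]

theorem y_y (h : BlockRelations q E G k k' l x y) : y * y = 0 := by
  nth_rewrite 2 [← h.l_y]
  rw [← mul_assoc, h.y_l, zero_mul]

/-- Up to a unit, `x` and `y` are partial inverses of each other. This follows by comparing the
two ways of writing `E * G * x`, once with `E * G` replaced by means of the commutator relation and
once after moving `G` and `E` past `x`. -/
theorem x_y_x (h : BlockRelations q E G k k' l x y) (hq0 : q ≠ 0) (hq2 : q - q⁻¹ ≠ 0)
    (hq4 : q ^ 2 + 1 ≠ 0) : x * (y * x) = q⁻¹ • (x * k') := by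
  have hEG : E * G = G * E + ((q - q⁻¹)⁻¹ • (k - k') - x * y + y * x) := by rw [← h.E_G]; abel
  have h1 : E * (G * x) = q ^ 2 • (x * (E * G)) := by
    rw [← h.x_G, ← mul_assoc, h.E_x, smul_mul_assoc, mul_assoc]
  rw [← mul_assoc, hEG] at h1
  have kx := h.k_x
  have k'x : k' * x = (q ^ 2)⁻¹ • (x * k') := by
    rw [h.x_k', smul_smul, inv_mul_cancel₀ (pow_ne_zero 2 hq0), one_smul]
  have e1 : G * (E * x) = q ^ 2 • (x * (G * E)) := by
    rw [h.E_x, mul_smul_comm, ← mul_assoc, ← mul_assoc, h.x_G]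
  simp only [add_mul, sub_mul, mul_add, mul_sub, smul_mul_assoc, mul_smul_comm, mul_assoc, e1,
    h.x_x, kx, k'x, mul_zero, mul_mul_eq_zero_of_mul_eq_zero h.x_x] at h1
  have h2 : (q ^ 2 + 1) • (x * (y * x)) = (q ^ 2 + 1) • (q⁻¹ • (x * k')) := by
    rw [← sub_eq_zero] at h1 ⊢
    rw [← neg_eq_zero, ← h1]
    have hq1 : q ^ 2 - 1 ≠ 0 := by
      have : q * (q - q⁻¹) = q ^ 2 - 1 := by field_simp
      exact this ▸ mul_ne_zero hq0 hq2
    match_scalars <;> field_simp <;> ring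
  exact smul_right_injective A hq4 h2

/-- The counterpart of `x_y_x` for `y`, where `E * G` is moved past `y`. -/
theorem y_x_y (h : BlockRelations q E G k k' l x y) (hq0 : q ≠ 0) (hq2 : q - q⁻¹ ≠ 0)
    (hq4 : q ^ 2 + 1 ≠ 0) : y * (x * y) = q • (y * k') := by
  have hEG : E * G = G * E + ((q - q⁻¹)⁻¹ • (k - k') - x * y + y * x) := by rw [← h.E_G]; abel
  have h1 : y * (E * G) = q ^ 2 • (E * G * y) := by
    rw [← mul_assoc, h.y_E, mul_assoc, h.y_G, mul_smul_comm, mul_assoc]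
  rw [hEG] at h1
  have e1 : y * (G * E) = q ^ 2 • (G * (E * y)) := by
    rw [← mul_assoc, h.y_G, smul_mul_assoc, mul_assoc, h.y_E]
  have ky : k * y = (q ^ 2)⁻¹ • (y * k) := by
    rw [h.y_k, smul_smul, inv_mul_cancel₀ (pow_ne_zero 2 hq0), one_smul]
  simp only [add_mul, sub_mul, mul_add, mul_sub, smul_mul_assoc, mul_smul_comm, mul_assoc, e1,
    h.y_y, ky, h.k'_y, mul_zero, mul_mul_eq_zero_of_mul_eq_zero h.y_y] at h1
  have h2 : (q ^ 2 + 1) • (y * (x * y)) = (q ^ 2 + 1) • (q • (y * k')) := by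
    rw [← sub_eq_zero] at h1 ⊢
    rw [← neg_eq_zero, ← h1]
    have hq1 : q ^ 2 - 1 ≠ 0 := by
      have : q * (q - q⁻¹) = q ^ 2 - 1 := by field_simp
      exact this ▸ mul_ne_zero hq0 hq2
    match_scalars <;> field_simp <;> ring
  exact smul_right_injective A hq4 h2

end BlockRelations

namespace BlockRelations

variable {K A : Type*} [Field K] [Ring A] [Algebra K A] {q : K} {E G k k' l x y : A}

/-- The central idempotent that cuts out the factor of `2 × 2` matrices. -/
def centralIdempotent (q : K) (k x y : A) : A := q⁻¹ • (x * (y * k)) + q • (y * (x * k))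

/-- The element that rescales the diagonal blocks `G` and `k` by powers of `q` on the matrix factor
so that they form a quantum triple together with `E`. The same expression with `q` and `q⁻¹`
exchanged is its inverse. -/
def rescale (q : K) (P l : A) : A := 1 - P + q⁻¹ • (P - P * l) + q • (P * l)

theorem commute_rescale {P z : A} (q : K) (hP : Commute P z) (hl : Commute l z) :
    Commute (rescale q P l) z :=
  ((((Commute.one_left z).sub_left hP).add_left
    ((hP.sub_left (hP.mul_left hl)).smul_left _)).add_left ((hP.mul_left hl).smul_left _))

theorem rescale_mul_idempotent {P : A} (q : K) (hPP : P * P = P) (hPl : Commute P l) :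
    rescale q P l * P = q⁻¹ • (P - P * l) + q • (P * l) := by
  have h1 : P * l * P = P * l := by rw [mul_assoc, ← hPl.eq, ← mul_assoc, hPP]
  simp only [rescale, add_mul, sub_mul, smul_mul_assoc, one_mul, hPP, h1, sub_self, zero_add]

theorem rescale_mul_mul {P : A} (q : K) (hPP : P * P = P) (hPl : Commute P l) (hll : l * l = l) :
    rescale q P l * (P * l) = q • (P * l) := by
  rw [← mul_assoc, rescale_mul_idempotent q hPP hPl]
  simp only [add_mul, sub_mul, smul_mul_assoc, mul_assoc, hll, sub_self, smul_zero, zero_add]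

theorem rescale_mul_rescale {P : A} (hq0 : q ≠ 0) (hPP : P * P = P) (hPl : Commute P l)
    (hll : l * l = l) : rescale q P l * rescale q⁻¹ P l = 1 := by
  nth_rewrite 2 [rescale]
  simp only [mul_add, mul_sub, mul_smul_comm, mul_one, rescale_mul_idempotent q hPP hPl,
    rescale_mul_mul q hPP hPl hll, inv_inv]
  rw [rescale]
  match_scalars <;> field_simp <;> ring

/-- The factor `x * k` in place of `x` is what commutes with `E`, and the rescaling by `Z` is what
makes `T` and `F` commute with the off-diagonal elements. -/
theorem matrixTriple (h : BlockRelations q E G k k' l x y) (hq0 : q ≠ 0) (hq2 : q - q⁻¹ ≠ 0)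
    (hq4 : q ^ 2 + 1 ≠ 0) {P Z Z' : A} (hP : P = centralIdempotent q k x y)
    (hZ : Z = rescale q P l) (hZ' : Z' = rescale q⁻¹ P l) :
    MatrixTriple q E (Z * G) (Z * k) (k' * Z') P l (q • (x * k)) y := by
  have xyx := h.x_y_x hq0 hq2 hq4
  have yxy := h.y_x_y hq0 hq2 hq4
  have kx := h.k_x
  have ky : k * y = q⁻¹ ^ 2 • (y * k) := by
    rw [h.y_k, smul_smul, ← mul_pow, inv_mul_cancel₀ hq0, one_pow, one_smul]
  have kG : k * G = q⁻¹ ^ 2 • (G * k) := by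
    rw [h.G_k, smul_smul, ← mul_pow, inv_mul_cancel₀ hq0, one_pow, one_smul]
  have kx' := mul_mul_eq_of_mul_eq_smul kx
  have ky' := mul_mul_eq_of_mul_eq_smul ky
  have lx' := mul_mul_eq_zero_of_mul_eq_zero h.l_x
  have yl' := mul_mul_eq_zero_of_mul_eq_zero h.y_l
  have xl' := mul_mul_eq_of_mul_eq h.x_l
  have ly' := mul_mul_eq_of_mul_eq h.l_y
  have xx' := mul_mul_eq_zero_of_mul_eq_zero h.x_x
  have yy' := mul_mul_eq_zero_of_mul_eq_zero h.y_y
  have kk'' := mul_mul_eq_of_mul_eq_one h.k_k'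
  have Ex' := mul_mul_eq_of_mul_eq_smul h.E_x
  have Ey := h.y_E.symm
  have Ey' := mul_mul_eq_of_mul_eq_mul Ey
  have Gx := h.x_G.symm
  have Gx' := mul_mul_eq_of_mul_eq_mul Gx
  have Gy : G * y = q⁻¹ ^ 2 • (y * G) := by
    rw [h.y_G, smul_smul, ← mul_pow, inv_mul_cancel₀ hq0, one_pow, one_smul]
  have Gy' := mul_mul_eq_of_mul_eq_smul Gy
  have xyxk : x * (y * (x * k)) = q⁻¹ • x := by
    have := congrArg (· * k) xyx
    simpa only [mul_assoc, smul_mul_assoc, h.k'_k, mul_one] using this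
  have yxyk : y * (x * (y * k)) = q • y := by
    have := congrArg (· * k) yxy
    simpa only [mul_assoc, smul_mul_assoc, h.k'_k, mul_one] using this
  have Px : P * x = x := by
    rw [hP, centralIdempotent]
    simp only [add_mul, smul_mul_assoc, mul_assoc, kx, mul_smul_comm, xyxk, mul_zero, xx',
      smul_smul, smul_zero, add_zero]
    rw [show q⁻¹ * (q ^ 2 * q⁻¹) = 1 by field_simp, one_smul]
  have xP : x * P = x := by
    rw [hP, centralIdempotent]
    simp only [mul_add, mul_smul_comm, xyxk, xx', smul_smul, smul_zero, zero_add]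
    rw [mul_inv_cancel₀ hq0, one_smul]
  have Py : P * y = y := by
    rw [hP, centralIdempotent]
    simp only [add_mul, smul_mul_assoc, mul_assoc, ky, mul_smul_comm, yxyk, mul_zero, yy',
      smul_smul, smul_zero, zero_add]
    rw [show q * (q⁻¹ ^ 2 * q) = 1 by field_simp, one_smul]
  have yP : y * P = y := by
    rw [hP, centralIdempotent]
    simp only [mul_add, mul_smul_comm, yxyk, yy', smul_smul, smul_zero, add_zero]
    rw [inv_mul_cancel₀ hq0, one_smul]
  have PP : P * P = P := by
    nth_rewrite 2 [hP]
    rw [centralIdempotent, mul_add, mul_smul_comm, mul_smul_comm, ← mul_assoc P x,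
      ← mul_assoc P y, Px, Py, ← centralIdempotent, ← hP]
  have Pk : P * k = k * P := by
    rw [hP, centralIdempotent]
    simp only [add_mul, mul_add, smul_mul_assoc, mul_smul_comm, mul_assoc, kx', ky', smul_smul]
    congr 2 <;> field_simp
  have PE : P * E = E * P := by
    rw [hP, centralIdempotent]
    simp only [add_mul, mul_add, smul_mul_assoc, mul_smul_comm, mul_assoc, h.k_E, Ey', Ex', smul_smul]
  have PG : P * G = G * P := by
    rw [hP, centralIdempotent]
    simp only [add_mul, mul_add, smul_mul_assoc, mul_smul_comm, mul_assoc, kG, Gy', Gx',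
      smul_smul]
  have lP : l * P = q • (y * (x * k)) := by
    rw [hP, centralIdempotent]
    simp only [mul_add, mul_smul_comm, lx', ly', smul_zero, zero_add]
  have Pl : P * l = q • (y * (x * k)) := by
    rw [hP, centralIdempotent]
    simp only [add_mul, smul_mul_assoc, mul_assoc, ← h.l_k, yl', xl', mul_zero, smul_zero, zero_add]
  have hPl : Commute P l := Pl.trans lP.symm
  have yxk : y * (x * k) = q⁻¹ • (P * l) := by
    rw [Pl, smul_smul, inv_mul_cancel₀ hq0, one_smul]
  have xyk : x * (y * k) = q • (P - P * l) := by
    rw [Pl, hP, centralIdempotent, add_sub_cancel_right, smul_smul, mul_inv_cancel₀ hq0, one_smul]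
  have xy : x * y = q • ((P - P * l) * k') := by
    rw [← smul_mul_assoc, ← xyk, mul_assoc, mul_assoc, h.k_k', mul_one]
  have yx : y * x = q⁻¹ • (P * l * k') := by
    rw [← smul_mul_assoc, ← yxk, mul_assoc, mul_assoc, h.k_k', mul_one]
  have ZE : Commute Z E := hZ ▸ commute_rescale q PE h.l_E
  have ZG : Commute Z G := hZ ▸ commute_rescale q PG h.l_G
  have Zk : Commute Z k := hZ ▸ commute_rescale q Pk h.l_k
  have ZP : Commute Z P := hZ ▸ commute_rescale q (Commute.refl P) hPl.symm
  have Zl : Commute Z l := hZ ▸ commute_rescale q hPl (Commute.refl l)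
  have hk'z : ∀ z : A, Commute z k → Commute z k' := by
    intro z hz
    calc z * k' = k' * (k * z) * k' := by rw [← mul_assoc, h.k'_k, one_mul]
      _ = k' * z := by rw [← hz.eq, mul_assoc, mul_assoc, h.k_k', mul_one]
  have Z'k : Commute Z' k := hZ' ▸ commute_rescale q⁻¹ Pk h.l_k
  have Z'k' : Commute Z' k' := hk'z _ Z'k
  have ZZ' : Z * Z' = 1 := by rw [hZ, hZ', rescale_mul_rescale hq0 PP hPl h.l_l]
  have Z'Z : Z' * Z = 1 := by
    have := rescale_mul_rescale (q := q⁻¹) (inv_ne_zero hq0) PP hPl h.l_l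
    rw [inv_inv] at this
    rw [hZ, hZ', this]
  have Zx : Z * x = q⁻¹ • x := by
    rw [hZ, rescale]
    simp only [add_mul, sub_mul, smul_mul_assoc, mul_assoc, h.l_x, Px, mul_zero, one_mul, sub_self,
      zero_add, smul_zero, add_zero, sub_zero]
  have xZ : x * Z = q • x := by
    have xPl : x * (P * l) = x := by rw [← mul_assoc, xP, h.x_l]
    rw [hZ, rescale]
    simp only [mul_add, mul_sub, mul_smul_comm, xPl, xP, mul_one, sub_self, zero_add, smul_zero]
  have Zy : Z * y = q • y := by
    rw [hZ, rescale]
    simp only [add_mul, sub_mul, smul_mul_assoc, mul_assoc, h.l_y, Py, one_mul, sub_self,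
      zero_add, smul_zero]
  have yZ : y * Z = q⁻¹ • y := by
    have yPl : y * (P * l) = 0 := by rw [← mul_assoc, yP, h.y_l]
    rw [hZ, rescale]
    simp only [mul_add, mul_sub, mul_smul_comm, yPl, yP, mul_one, sub_self, zero_add, smul_zero,
      sub_zero, add_zero]
  have Zx' := mul_mul_eq_of_mul_eq Zx
  have xZ' := mul_mul_eq_of_mul_eq xZ
  have Zy' := mul_mul_eq_of_mul_eq Zy
  have yZ' := mul_mul_eq_of_mul_eq yZ
  have kZ' := mul_mul_eq_of_mul_eq_mul Zk.symm.eq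
  have GZ' := mul_mul_eq_of_mul_eq_mul ZG.symm.eq
  have EZ' := mul_mul_eq_of_mul_eq_mul ZE.symm.eq
  have ZEG : Z * (E * G - G * E) = (q - q⁻¹)⁻¹ • (Z * k - k' * Z') := by
    have e1 : Z * (P * l) = q • (P * l) := by rw [hZ, rescale_mul_mul q PP hPl h.l_l]
    have e2 : Z * P = q⁻¹ • (P - P * l) + q • (P * l) := by
      rw [hZ, rescale_mul_idempotent q PP hPl]
    -- the identity without its `k`-term, before multiplication by `k'` on the right
    have e3 : Z * (-((q - q⁻¹)⁻¹ • 1) - q • (P - P * l) + q⁻¹ • (P * l)) =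
        -((q - q⁻¹)⁻¹ • Z') := by
      simp only [mul_add, mul_sub, mul_neg, mul_smul_comm, mul_one, e1, e2]
      rw [hZ, hZ', rescale, rescale, inv_inv]
      have hq1 : q ^ 2 - 1 ≠ 0 := by
        have : q * (q - q⁻¹) = q ^ 2 - 1 := by field_simp
        exact this ▸ mul_ne_zero hq0 hq2
      match_scalars <;> field_simp <;> ring
    have e4 := congrArg (· * k') e3
    simp only [mul_assoc, add_mul, sub_mul, neg_mul, smul_mul_assoc, one_mul] at e4
    rw [h.E_G, xy, yx, ← Z'k'.eq, smul_sub _ (Z * k), sub_eq_add_neg (_ • (Z * k)), ← e4]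
    simp only [mul_add, mul_sub, mul_neg, mul_smul_comm, smul_sub, sub_mul, mul_assoc]
    abel
  refine ⟨⟨?_, ?_, ?_, ?_, ?_⟩, PE, ?_, ?_, h.l_E, ?_, ?_, ?_, ?_, ?_, h.y_E, ?_, ?_, PP, h.l_l, hPl,
    ?_, ?_, ?_, ?_, Py, yP, ?_, ?_, h.l_y, h.y_l⟩
  · rw [mul_assoc, kk'', ZZ']
  · rw [mul_assoc, mul_mul_eq_of_mul_eq_one Z'Z, h.k'_k]
  · rw [mul_assoc, h.k_E, mul_smul_comm, ← mul_assoc, ZE.eq, mul_assoc]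
  · rw [mul_assoc, GZ', h.G_k, mul_assoc, kZ']
    simp only [mul_smul_comm]
  · rw [← ZEG, EZ', mul_assoc, mul_sub]
  · exact (ZP.symm.mul_right PG)
  · exact (ZP.symm.mul_right Pk)
  · exact (Zl.symm.mul_right h.l_G)
  · exact (Zl.symm.mul_right h.l_k)
  · refine Commute.smul_left ?_ q
    rw [Commute, SemiconjBy, mul_assoc, h.k_E, mul_smul_comm, ← mul_assoc, ← mul_assoc, h.E_x,
      smul_mul_assoc]
  · refine Commute.smul_left ?_ q
    rw [Commute, SemiconjBy, mul_assoc, kZ', xZ', kG, mul_assoc, Gx', Zx']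
    simp only [smul_mul_assoc, mul_smul_comm, smul_smul]
    congr 1
    field_simp
  · refine Commute.smul_left ?_ q
    rw [Commute, SemiconjBy, mul_assoc, kZ', xZ', mul_assoc, kx', mul_smul_comm, Zx']
    simp only [smul_mul_assoc, smul_smul]
    congr 1
    field_simp
  · rw [Commute, SemiconjBy, yZ', mul_assoc, Gy, mul_smul_comm, Zy']
    simp only [smul_mul_assoc, smul_smul]
    congr 1
    field_simp
  · rw [Commute, SemiconjBy, yZ', mul_assoc, ky, mul_smul_comm, Zy']
    simp only [smul_mul_assoc, smul_smul]
    congr 1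
    field_simp
  · rw [smul_mul_assoc, mul_assoc, ky, mul_smul_comm, xyk, smul_smul, smul_smul]
    rw [show q * q⁻¹ ^ 2 * q = 1 by field_simp, one_smul]
  · rw [mul_smul_comm, Pl]
  · rw [mul_smul_comm, ← mul_assoc, Px]
  · rw [smul_mul_assoc, mul_assoc, ← Pk, ← mul_assoc, xP]
  · rw [mul_smul_comm, ← mul_assoc, h.l_x, zero_mul, smul_zero]
  · rw [smul_mul_assoc, mul_assoc, ← h.l_k, xl']

/-- The factor of the Casimir element that comes from the matrix units: it is `q⁻¹` on
`(1 - P) * (1 - l)`, `q` on `(1 - P) * l` and `1` on `P`. -/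
def casimirFactor (q : K) (P l : A) : A :=
  q⁻¹ • (1 - l) + q • l - (q⁻¹ • (P - P * l) + q • (P * l)) + P

/-- The mirabolic Casimir element is the Casimir element of the quantum triple, multiplied by a
central element. -/
theorem casimir_eq (h : BlockRelations q E G k k' l x y) (hq0 : q ≠ 0) (hq2 : q - q⁻¹ ≠ 0)
    {P Z Z' e f : A} (hZ : Z = rescale q P l) (hZ' : Z' = rescale q⁻¹ P l)
    (m : MatrixTriple q E (Z * G) (Z * k) (k' * Z') P l (q • (x * k)) y)
    (he : e = E + x) (hf : f = G + y) :
    (1 - q⁻¹ ^ 2) • (f * e + ((q - q⁻¹) ^ 2)⁻¹ • (q • k + q⁻¹ • k'))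
      - f * e * l - l * f * e + q ^ 2 • (f * l * e) + q⁻¹ ^ 2 • (e * l * f)
      + (q ^ 2 - 2) • (l * (((q - q⁻¹) ^ 2)⁻¹ • (q • k + q⁻¹ • k')))
      + q⁻¹ ^ 2 • (l * (((q - q⁻¹) ^ 2)⁻¹ • (q⁻¹ • k + q • k'))) =
    (q - q⁻¹) • (casimirFactor q P l *
      (Z * G * E + ((q - q⁻¹) ^ 2)⁻¹ • (q • (Z * k) + q⁻¹ • (k' * Z')))) := by
  have hPl : Commute P l := m.P_l
  have ZP : Commute Z P := hZ ▸ commute_rescale q (Commute.refl P) hPl.symm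
  have Zl : Commute Z l := hZ ▸ commute_rescale q hPl (Commute.refl l)
  have Z'l : Commute Z' l := hZ' ▸ commute_rescale q⁻¹ hPl (Commute.refl l)
  have Z'P : Commute Z' P := hZ' ▸ commute_rescale q⁻¹ (Commute.refl P) hPl.symm
  have zPl : Z * (P * l) = q • (P * l) := by rw [hZ, rescale_mul_mul q m.P_P hPl h.l_l]
  have zP : Z * P = q⁻¹ • (P - P * l) + q • (P * l) := by
    rw [hZ, rescale_mul_idempotent q m.P_P hPl]
  have z'Pl : Z' * (P * l) = q⁻¹ • (P * l) := by rw [hZ', rescale_mul_mul q⁻¹ m.P_P hPl h.l_l]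
  have z'P : Z' * P = q • (P - P * l) + q⁻¹ • (P * l) := by
    rw [hZ', rescale_mul_idempotent q⁻¹ m.P_P hPl, inv_inv]
  have hPll : P * l * l = P * l := by rw [mul_assoc, h.l_l]
  have zl : Z * l = l - P * l + q • (P * l) := by
    rw [hZ, rescale]
    simp only [add_mul, sub_mul, smul_mul_assoc, one_mul, hPll]
    simp
  have z'l : Z' * l = l - P * l + q⁻¹ • (P * l) := by
    rw [hZ', rescale]
    simp only [add_mul, sub_mul, smul_mul_assoc, one_mul, hPll]
    simp
  have DZ : casimirFactor q P l * Z = q⁻¹ • (1 - l) + q • l := by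
    have hc : Commute Z (casimirFactor q P l) := by
      unfold casimirFactor
      exact ((((((Commute.one_right _).sub_right Zl).smul_right _).add_right
        (Zl.smul_right _)).sub_right (((ZP.sub_right (ZP.mul_right Zl)).smul_right _).add_right
          ((ZP.mul_right Zl).smul_right _))).add_right ZP)
    rw [← hc.eq, casimirFactor]
    simp only [mul_add, mul_sub, mul_smul_comm, mul_one, zPl, zP, zl]
    rw [hZ, rescale]
    match_scalars <;> field_simp <;> ring
  have DZ' : casimirFactor q P l * Z' = q⁻¹ • (1 - l) + q • l +
      (q - q⁻¹) • (P - P * l - P * l) := by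
    have hc : Commute Z' (casimirFactor q P l) := by
      unfold casimirFactor
      exact ((((((Commute.one_right _).sub_right Z'l).smul_right _).add_right
        (Z'l.smul_right _)).sub_right (((Z'P.sub_right (Z'P.mul_right Z'l)).smul_right _).add_right
          ((Z'P.mul_right Z'l).smul_right _))).add_right Z'P)
    rw [← hc.eq, casimirFactor]
    simp only [mul_add, mul_sub, mul_smul_comm, mul_one, z'Pl, z'P, z'l]
    rw [hZ', rescale, inv_inv]
    match_scalars <;> field_simp <;> ring
  have ky : k * y = q⁻¹ ^ 2 • (y * k) := by
    rw [h.y_k, smul_smul, ← mul_pow, inv_mul_cancel₀ hq0, one_pow, one_smul]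
  have hxy : (P - P * l) * k' = q⁻¹ • (x * y) := by
    rw [← m.X_Y, smul_mul_assoc, smul_mul_assoc, mul_assoc x k, ky, mul_smul_comm, smul_mul_assoc,
      mul_assoc x, mul_assoc y, h.k_k', mul_one, smul_smul]
    congr 1
    field_simp
  have hyx : P * l * k' = q • (y * x) := by
    rw [← m.Y_X, mul_smul_comm, smul_mul_assoc, mul_assoc, mul_assoc, h.k_k', mul_one]
  have Z'Z : Z' * Z = 1 := by
    have := rescale_mul_rescale (q := q⁻¹) (inv_ne_zero hq0) m.P_P hPl h.l_l
    rw [inv_inv] at this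
    rw [hZ, hZ', this]
  have Pk : Commute P k := by
    have := Z'P.symm.mul_right m.P_T
    rwa [mul_mul_eq_of_mul_eq_one Z'Z] at this
  have Z'k : Commute Z' k := hZ' ▸ commute_rescale q⁻¹ Pk h.l_k
  have Z'k' : Commute Z' k' := by
    calc Z' * k' = k' * (k * Z') * k' := by rw [← mul_assoc, h.k'_k, one_mul]
      _ = k' * Z' := by rw [← Z'k.eq, mul_assoc, mul_assoc, h.k_k', mul_one]
  have DZ'k : casimirFactor q P l * (k' * Z') = q⁻¹ • (k' - l * k') + q • (l * k') +
      (q - q⁻¹) • (q⁻¹ • (x * y) - q • (y * x)) := by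
    rw [← Z'k'.eq, ← mul_assoc, DZ', add_mul, add_mul, smul_mul_assoc, smul_mul_assoc,
      smul_mul_assoc, sub_mul, sub_mul (P - P * l), hxy, hyx, one_mul]
  have DZk : casimirFactor q P l * (Z * k) = q⁻¹ • (k - l * k) + q • (l * k) := by
    rw [← mul_assoc, DZ, add_mul, smul_mul_assoc, smul_mul_assoc, sub_mul, one_mul]
  have DZG : casimirFactor q P l * (Z * G * E) =
      q⁻¹ • (G * E - l * (G * E)) + q • (l * (G * E)) := by
    rw [← mul_assoc, ← mul_assoc, DZ, add_mul, smul_mul_assoc, smul_mul_assoc, sub_mul, one_mul,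
      add_mul, smul_mul_assoc, smul_mul_assoc, sub_mul, mul_assoc]
  rw [mul_add (casimirFactor q P l), mul_smul_comm _ (casimirFactor q P l),
    mul_add (casimirFactor q P l), mul_smul_comm _ (casimirFactor q P l),
    mul_smul_comm _ (casimirFactor q P l), DZG, DZk, DZ'k, he, hf]
  have lx' := mul_mul_eq_zero_of_mul_eq_zero h.l_x
  have ly' := mul_mul_eq_of_mul_eq h.l_y
  have Gl := h.l_G.symm
  have El := h.l_E.symm
  have Gl' := mul_mul_eq_of_mul_eq_mul Gl
  have El' := mul_mul_eq_of_mul_eq_mul El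
  have hEG : E * G = G * E + ((q - q⁻¹)⁻¹ • (k - k') - x * y + y * x) := by rw [← h.E_G]; abel
  have lEy : l * (E * y) = E * y := by rw [← El', h.l_y]
  have lGx : l * (G * x) = 0 := by rw [← Gl', h.l_x, mul_zero]
  simp only [mul_add, add_mul, mul_sub, mul_assoc, El, Gl, Gl', lx', ly', h.x_l, h.y_l,
    h.l_y, lEy, lGx, h.x_G, h.y_E, hEG, mul_smul_comm, mul_zero, zero_mul]
  have hq1 : q ^ 2 - 1 ≠ 0 := by
    have : q * (q - q⁻¹) = q ^ 2 - 1 := by field_simp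
    exact this ▸ mul_ne_zero hq0 hq2
  match_scalars <;> field_simp <;> ring

end BlockRelations

/-! ### Highest weight vectors generate simple modules -/

/-- `w` is a highest weight vector of weight `a` for the quantum triple, and an eigenvector of the
idempotents `P` and `l` with eigenvalues `p` and `s`. -/
structure IsHighestWeightVector {K A M : Type*} [Field K] [Ring A] [AddCommGroup M] [Module K M]
    [Module A M] (E T P l : A) (w : M) (a p s : K) : Prop where
  ne_zero : w ≠ 0
  E_smul : E • w = 0
  T_smul : T • w = a • w
  P_smul : P • w = p • w
  l_smul : l • w = s • w

/-- The labels of the simple modules: the weight `a` is `± q ^ n`, and the pair of eigenvalues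
`(p, s)` singles out one of the three blocks. In the matrix block `p = 1` the normalization
`s = 0` picks one of the two equivalent diagonal matrix units. -/
structure IsDominantLabel {K : Type*} [Field K] (q : K) (n : ℕ) (a p s : K) : Prop where
  sq_eq : a ^ 2 = q ^ (2 * n)
  block : (p = 0 ∧ s = 0) ∨ (p = 0 ∧ s = 1) ∨ (p = 1 ∧ s = 0)

theorem IsDominantLabel.ne_zero {K : Type*} [Field K] {q : K} {n : ℕ} {a p s : K}
    (h : IsDominantLabel q n a p s) (hq0 : q ≠ 0) : a ≠ 0 := by
  rintro rfl
  exact pow_ne_zero (2 * n) hq0 (by rw [← h.sq_eq]; simp)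

/-- The joint eigenspace of the idempotents `P` and `l`. -/
def blockSubspace (K : Type*) {A : Type*} (M : Type*) [Field K] [Ring A] [Algebra K A]
    [AddCommGroup M] [Module K M] [Module A M] [IsScalarTower K A M] (P l : A) (p s : K) :
    Submodule K M where
  carrier := {x | P • x = p • x ∧ l • x = s • x}
  add_mem' hx hy := ⟨by rw [smul_add, smul_add, hx.1, hy.1], by rw [smul_add, smul_add, hx.2, hy.2]⟩
  zero_mem' := by simp
  smul_mem' c x hx :=
    ⟨by rw [smul_algebra_smul_comm, hx.1, smul_comm], by rw [smul_algebra_smul_comm, hx.2, smul_comm]⟩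

theorem smul_mem_blockSubspace {K A M : Type*} [Field K] [Ring A] [Algebra K A]
    [AddCommGroup M] [Module K M] [Module A M] [IsScalarTower K A M] {P l g : A} {p s : K}
    (hP : Commute P g) (hl : Commute l g) {x : M} (hx : x ∈ blockSubspace K M P l p s) :
    g • x ∈ blockSubspace K M P l p s :=
  ⟨by rw [smul_smul, hP.eq, mul_smul, hx.1, smul_algebra_smul_comm],
    by rw [smul_smul, hl.eq, mul_smul, hx.2, smul_algebra_smul_comm]⟩

theorem commute_aeval {K A : Type*} [Field K] [Ring A] [Algebra K A] {g T : A} (h : Commute g T)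
    (b : K[X]) : Commute g (aeval T b) := by
  induction b using Polynomial.induction_on' with
  | add r s hr hs => rw [map_add]; exact hr.add_right hs
  | monomial n c =>
    rw [aeval_monomial]
    exact (Algebra.commute_algebraMap_right c g).mul_right (h.pow_right n)

namespace MatrixTriple

variable {K A M : Type*} [Field K] [Ring A] [Algebra K A] {q : K} {E F T T' P l X Y : A}
  [AddCommGroup M] [Module K M] [Module A M] [IsScalarTower K A M]

theorem commute_T' (h : MatrixTriple q E F T T' P l X Y) {z : A} (hz : Commute z T) :
    Commute z T' := by
  calc z * T' = T' * (T * z) * T' := by rw [← mul_assoc, h.T'_T, one_mul]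
    _ = T' * z := by rw [← hz.eq, mul_assoc, mul_assoc, h.T_T', mul_one]

theorem exists_isHighestWeightVector [FiniteDimensional K M] [Nontrivial M]
    (h : MatrixTriple q E F T T' P l X Y) (hq0 : q ≠ 0) (hq : ∀ n : ℕ, 0 < n → q ^ n ≠ 1) :
    ∃ (w : M) (n : ℕ) (a p s : K), IsHighestWeightVector E T P l w a p s ∧
      IsDominantLabel q n a p s := by
  -- it suffices to find a nonzero vector in one of the three joint eigenspaces
  suffices hs : ∃ (x : M) (p s : K), x ≠ 0 ∧ x ∈ blockSubspace K M P l p s ∧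
      ((p = 0 ∧ s = 0) ∨ (p = 0 ∧ s = 1) ∨ (p = 1 ∧ s = 0)) by
    obtain ⟨x, p, s, hx0, hx, hps⟩ := hs
    obtain ⟨w, hw, hw0, hE, a, n, ha, hT⟩ :=
      h.toQuantumTriple.exists_highest_weight_vector hq0 hq (blockSubspace K M P l p s)
        (fun y hy => smul_mem_blockSubspace h.P_E h.l_E hy)
        (fun y hy => smul_mem_blockSubspace h.P_T h.l_T hy) hx hx0
    exact ⟨w, n, a, p, s, ⟨hw0, hE, hT, hw.1, hw.2⟩, ⟨ha, hps⟩⟩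
  have hlP : l * P = P * l := h.P_l.symm.eq
  have hPl' : P * (P * l) = P * l := by rw [← mul_assoc, h.P_P]
  have hlPl : l * (P * l) = P * l := by rw [← mul_assoc, hlP, mul_assoc, h.l_l]
  obtain ⟨x, hx⟩ := exists_ne (0 : M)
  by_cases h1 : (1 - P - l + P * l) • x = 0
  swap
  · refine ⟨_, 0, 0, h1, ⟨?_, ?_⟩, Or.inl ⟨rfl, rfl⟩⟩
    · rw [smul_smul, zero_smul, mul_add, mul_sub, mul_sub, mul_one, h.P_P, hPl']
      simp
    · rw [smul_smul, zero_smul, mul_add, mul_sub, mul_sub, mul_one, h.l_l, hlP, hlPl]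
      simp
  by_cases h2 : (l - P * l) • x = 0
  swap
  · refine ⟨_, 0, 1, h2, ⟨?_, ?_⟩, Or.inr (Or.inl ⟨rfl, rfl⟩)⟩
    · rw [smul_smul, zero_smul, mul_sub, hPl', sub_self, zero_smul]
    · rw [smul_smul, one_smul, mul_sub, h.l_l, hlPl]
  by_cases h3 : (P - P * l) • x = 0
  swap
  · refine ⟨_, 1, 0, h3, ⟨?_, ?_⟩, Or.inr (Or.inr ⟨rfl, rfl⟩)⟩
    · rw [smul_smul, one_smul, mul_sub, h.P_P, hPl']
    · rw [smul_smul, zero_smul, mul_sub, hlP, hlPl, sub_self, zero_smul]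
  refine ⟨X • x, 1, 0, ?_, ⟨?_, ?_⟩, Or.inr (Or.inr ⟨rfl, rfl⟩)⟩
  · intro h4
    apply hx
    have h5 : (P * l) • x = 0 := by rw [← h.Y_X, mul_smul, h4, smul_zero]
    have : (1 : A) = (1 - P - l + P * l) + (l - P * l) + (P - P * l) + P * l := by abel
    rw [← one_smul A x, this, add_smul, add_smul, add_smul, h1, h2, h3, h5]
    simp
  · rw [smul_smul, h.P_X, one_smul]
  · rw [smul_smul, h.l_X, zero_smul, zero_smul]

variable {w : M} {n : ℕ} {a p s : K}

theorem string_le_blockSubspace (h : MatrixTriple q E F T T' P l X Y)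
    (hw : IsHighestWeightVector E T P l w a p s) :
    Submodule.span K (Set.range fun i : ℕ => F ^ i • w) ≤ blockSubspace K M P l p s := by
  rw [Submodule.span_le]
  rintro _ ⟨i, rfl⟩
  exact smul_mem_blockSubspace (h.P_F.pow_right i) (h.l_F.pow_right i) ⟨hw.P_smul, hw.l_smul⟩

theorem X_smul_eq_zero (h : MatrixTriple q E F T T' P l X Y) (hd : IsDominantLabel q n a p s)
    {x : M} (hx : x ∈ blockSubspace K M P l p s) : X • x = 0 := by
  rcases hd.block with ⟨rfl, -⟩ | ⟨rfl, -⟩ | ⟨-, rfl⟩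
  · rw [← h.X_P, mul_smul, hx.1, zero_smul, smul_zero]
  · rw [← h.X_P, mul_smul, hx.1, zero_smul, smul_zero]
  · rw [← h.X_l, mul_smul, hx.2, zero_smul, smul_zero]

/-- The submodule generated by a highest weight vector `w` is spanned by the strings through `w`
and `Y • w`. -/
theorem exists_eq_add_Y_smul (h : MatrixTriple q E F T T' P l X Y)
    (hgen : Algebra.adjoin K ({E, F, T, T', P, l, X, Y} : Set A) = ⊤)
    (hq0 : q ≠ 0) (hq : ∀ n : ℕ, 0 < n → q ^ n ≠ 1)
    (hw : IsHighestWeightVector E T P l w a p s) (hd : IsDominantLabel q n a p s) {x : M}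
    (hx : x ∈ Submodule.span A {w}) :
    ∃ u ∈ Submodule.span K (Set.range fun i : ℕ => F ^ i • w),
      ∃ u' ∈ Submodule.span K (Set.range fun i : ℕ => F ^ i • w), x = u + Y • u' := by
  set L := Submodule.span K (Set.range fun i : ℕ => F ^ i • w) with hL
  have hLb : L ≤ blockSubspace K M P l p s := h.string_le_blockSubspace hw
  let S : Submodule K M := L ⊔ L.map (Algebra.lsmul K K M Y)
  have hS : ∀ y, y ∈ S ↔ ∃ u ∈ L, ∃ u' ∈ L, y = u + Y • u' := by
    intro y
    simp only [S, Submodule.mem_sup, Submodule.mem_map]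
    constructor
    · rintro ⟨u, hu, _, ⟨u', hu', rfl⟩, rfl⟩
      exact ⟨u, hu, u', hu', rfl⟩
    · rintro ⟨u, hu, u', hu', rfl⟩
      exact ⟨u, hu, _, ⟨u', hu', rfl⟩, rfl⟩
  rw [← hS]
  have hstr := fun g hg u hu => h.toQuantumTriple.string_stable hq0 hq hw.E_smul
    (hd.ne_zero hq0) hw.T_smul (x := u) hu g hg
  have hcomm : ∀ g ∈ ({E, F, T, T'} : Set A), Commute Y g := by
    intro g hg
    simp only [Set.mem_insert_iff, Set.mem_singleton_iff] at hg
    rcases hg with rfl | rfl | rfl | rfl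
    · exact h.Y_E
    · exact h.Y_F
    · exact h.Y_T
    · exact h.commute_T' h.Y_T
  have h1 : ∀ g ∈ ({E, F, T, T'} : Set A), ∀ y ∈ S, g • y ∈ S := by
    intro g hg y hy
    obtain ⟨u, hu, u', hu', rfl⟩ := (hS y).mp hy
    refine (hS _).mpr ⟨g • u, hstr g hg u hu, g • u', hstr g hg u' hu', ?_⟩
    rw [smul_add, smul_smul, smul_smul, (hcomm g hg).eq]
  have h2 : ∀ g ∈ ({P, l, X, Y} : Set A), ∀ y ∈ S, g • y ∈ S := by
    intro g hg y hy
    obtain ⟨u, hu, u', hu', rfl⟩ := (hS y).mp hy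
    have hb := hLb hu
    have hb' := hLb hu'
    simp only [Set.mem_insert_iff, Set.mem_singleton_iff] at hg
    rcases hg with hg | hg | hg | hg
    · refine (hS _).mpr ⟨p • u, L.smul_mem _ hu, u', hu', ?_⟩
      rw [hg, smul_add, smul_smul, h.P_Y, hb.1]
    · refine (hS _).mpr ⟨s • u, L.smul_mem _ hu, u', hu', ?_⟩
      rw [hg, smul_add, smul_smul, h.l_Y, hb.2]
    · refine (hS _).mpr ⟨(p - p * s) • u', L.smul_mem _ hu', 0, L.zero_mem, ?_⟩
      have hXY : (P - P * l) • u' = (p - p * s) • u' := by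
        rw [sub_smul, mul_smul, hb'.2, smul_algebra_smul_comm, hb'.1, smul_smul, ← sub_smul,
          mul_comm s p]
      rw [hg, smul_add, smul_smul, h.X_Y, h.X_smul_eq_zero hd hb, hXY]
      simp
    · refine (hS _).mpr ⟨0, L.zero_mem, u, hu, ?_⟩
      have hYY : Y * Y = 0 := by
        nth_rewrite 2 [← h.l_Y]
        rw [← mul_assoc, h.Y_l, zero_mul]
      rw [hg, smul_add, smul_smul, hYY, zero_smul, add_zero, zero_add]
  have hall : ∀ b : A, ∀ y ∈ S, b • y ∈ S := by
    intro b
    have hb : b ∈ Algebra.adjoin K ({E, F, T, T', P, l, X, Y} : Set A) := by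
      rw [hgen]; exact Algebra.mem_top
    induction hb using Algebra.adjoin_induction with
    | mem g hg =>
      simp only [Set.mem_insert_iff, Set.mem_singleton_iff] at hg h1 h2
      rcases hg with hg | hg | hg | hg | hg | hg | hg | hg
      · exact h1 g (by simp [hg])
      · exact h1 g (by simp [hg])
      · exact h1 g (by simp [hg])
      · exact h1 g (by simp [hg])
      · exact h2 g (by simp [hg])
      · exact h2 g (by simp [hg])
      · exact h2 g (by simp [hg])
      · exact h2 g (by simp [hg])
    | algebraMap c => intro y hy; rw [algebraMap_smul]; exact S.smul_mem _ hy
    | add b c _ _ hb hc => intro y hy; rw [add_smul]; exact S.add_mem (hb y hy) (hc y hy)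
    | mul b c _ _ hb hc => intro y hy; rw [mul_smul]; exact hb _ (hc y hy)
  obtain ⟨b, rfl⟩ := Submodule.mem_span_singleton.mp hx
  refine hall b w ((hS w).mpr ⟨w, ?_, 0, L.zero_mem, by simp⟩)
  exact Submodule.subset_span ⟨0, by simp⟩

/-- A highest weight vector generates a simple module. -/
theorem isSimpleModule_span [FiniteDimensional K M] (h : MatrixTriple q E F T T' P l X Y)
    (hgen : Algebra.adjoin K ({E, F, T, T', P, l, X, Y} : Set A) = ⊤)
    (hq0 : q ≠ 0) (hq : ∀ n : ℕ, 0 < n → q ^ n ≠ 1)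
    (hw : IsHighestWeightVector E T P l w a p s) (hd : IsDominantLabel q n a p s) :
    IsSimpleModule A (Submodule.span A {w}) := by
  rw [isSimpleModule_iff_isAtom]
  refine ⟨by simpa using hw.ne_zero, fun N hN => ?_⟩
  by_contra hN0
  apply hN.not_ge
  rw [Submodule.span_singleton_le_iff_mem]
  obtain ⟨x, hxN, hx0⟩ := N.ne_bot_iff.mp hN0
  obtain ⟨u, hu, u', hu', rfl⟩ := h.exists_eq_add_Y_smul hgen hq0 hq hw hd (hN.le hxN)
  have hb := h.string_le_blockSubspace hw hu
  have hb' := h.string_le_blockSubspace hw hu'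
  -- a nonzero vector of `N` in the string through `w` is moved to `w` by a power of `E`
  have key : ∀ y ∈ N, y ≠ 0 → y ∈ Submodule.span K (Set.range fun i : ℕ => F ^ i • w) → w ∈ N := by
    intro y hy hy0 hyL
    obtain ⟨j, c, hc, hjc⟩ :=
      h.toQuantumTriple.exists_E_pow_smul_eq hq0 hq hw.E_smul hd.sq_eq hw.T_smul hyL hy0
    have h1 : c • w ∈ N := hjc ▸ N.smul_mem _ hy
    have h2 := N.smul_mem (algebraMap K A c⁻¹) h1
    rwa [algebraMap_smul, smul_smul, inv_mul_cancel₀ hc, one_smul] at h2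
  by_cases hu0 : u = 0
  · subst hu0
    rw [zero_add] at hxN hx0
    rcases hd.block with ⟨rfl, -⟩ | ⟨rfl, -⟩ | ⟨rfl, rfl⟩
    · exact absurd (by rw [← h.Y_P, mul_smul, hb'.1, zero_smul, smul_zero]) hx0
    · exact absurd (by rw [← h.Y_P, mul_smul, hb'.1, zero_smul, smul_zero]) hx0
    · have hXY : X • Y • u' = u' := by
        rw [smul_smul, h.X_Y, sub_smul, mul_smul, hb'.2, hb'.1]; simp
      refine key u' (hXY ▸ N.smul_mem X hxN) ?_ hu'
      rintro rfl
      simp at hx0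
  · refine key u ?_ hu0 hu
    -- `1 - P * l` is the projection onto the first summand
    have hPlu : (P * l) • u = 0 := by
      rcases hd.block with ⟨rfl, rfl⟩ | ⟨rfl, rfl⟩ | ⟨rfl, rfl⟩ <;>
        simp [mul_smul, hb.1, hb.2]
    have hproj : (1 - P * l) • (u + Y • u') = u := by
      rw [smul_add, smul_smul, sub_mul, mul_assoc, h.l_Y, h.P_Y, one_mul, sub_self, zero_smul,
        sub_smul, hPlu, one_smul, sub_zero, add_zero]
    exact hproj ▸ N.smul_mem _ hxN

/-- Simple modules with highest weight vectors of the same label are isomorphic: the pair of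
highest weight vectors generates a simple submodule of the product, which projects onto both
factors. -/
theorem nonempty_linearEquiv {N : Type*} [AddCommGroup N] [Module K N] [Module A N]
    [IsScalarTower K A N] [FiniteDimensional K M] [FiniteDimensional K N] [IsSimpleModule A M]
    [IsSimpleModule A N] (h : MatrixTriple q E F T T' P l X Y)
    (hgen : Algebra.adjoin K ({E, F, T, T', P, l, X, Y} : Set A) = ⊤)
    (hq0 : q ≠ 0) (hq : ∀ n : ℕ, 0 < n → q ^ n ≠ 1) {w' : N}
    (hw : IsHighestWeightVector E T P l w a p s) (hw' : IsHighestWeightVector E T P l w' a p s)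
    (hd : IsDominantLabel q n a p s) : Nonempty (M ≃ₗ[A] N) := by
  have hww : IsHighestWeightVector E T P l (w, w') a p s :=
    ⟨fun h0 => hw.ne_zero (congrArg Prod.fst h0), Prod.ext hw.E_smul hw'.E_smul,
      Prod.ext hw.T_smul hw'.T_smul, Prod.ext hw.P_smul hw'.P_smul,
      Prod.ext hw.l_smul hw'.l_smul⟩
  have hsimple := h.isSimpleModule_span hgen hq0 hq hww hd
  set S := Submodule.span A {(w, w')}
  have hmem : (w, w') ∈ S := Submodule.mem_span_singleton_self _
  let f : S →ₗ[A] M := (LinearMap.fst A M N).comp S.subtype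
  let g : S →ₗ[A] N := (LinearMap.snd A M N).comp S.subtype
  have hf : f ≠ 0 := fun h0 => hw.ne_zero (LinearMap.congr_fun h0 ⟨_, hmem⟩)
  have hg : g ≠ 0 := fun h0 => hw'.ne_zero (LinearMap.congr_fun h0 ⟨_, hmem⟩)
  exact ⟨(LinearEquiv.ofBijective f (LinearMap.bijective_of_ne_zero hf)).symm.trans
    (LinearEquiv.ofBijective g (LinearMap.bijective_of_ne_zero hg))⟩

/-! ### Complete reducibility -/

/-- Finite-dimensional modules are generated by their simple submodules. Otherwise the quotient by
the sum of all simple submodules has a highest weight vector; since `E` is surjective between the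
relevant weight spaces, it lifts to a highest weight vector. -/
theorem isSemisimpleModule [CharZero K] [FiniteDimensional K M]
    (h : MatrixTriple q E F T T' P l X Y)
    (hgen : Algebra.adjoin K ({E, F, T, T', P, l, X, Y} : Set A) = ⊤)
    (hq0 : q ≠ 0) (hq : ∀ n : ℕ, 0 < n → q ^ n ≠ 1) : IsSemisimpleModule A M := by
  rw [← sSup_simples_eq_top_iff_isSemisimpleModule]
  set N : Submodule A M := sSup {m : Submodule A M | IsSimpleModule A m} with hN
  by_contra hne
  have hmemN : ∀ {w : M} {n : ℕ} {a p s : K}, IsHighestWeightVector E T P l w a p s →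
      IsDominantLabel q n a p s → w ∈ N := by
    intro w n a p s hw hd
    have : Submodule.span A {w} ≤ N := le_sSup (h.isSimpleModule_span hgen hq0 hq hw hd)
    exact this (Submodule.mem_span_singleton_self w)
  have hnt : Nontrivial (M ⧸ N) := Submodule.Quotient.nontrivial_iff.mpr hne
  let π : M →ₗ[A] M ⧸ N := N.mkQ
  have hfd : FiniteDimensional K (M ⧸ N) :=
    Module.Finite.of_surjective (π.restrictScalars K) N.mkQ_surjective
  obtain ⟨w, n, a, p, s, hw, hd⟩ := h.exists_isHighestWeightVector (M := M ⧸ N) hq0 hq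
  obtain ⟨x, hx⟩ := N.mkQ_surjective w
  -- project a lift of `w` to the joint eigenspace of `P` and `l` ...
  obtain ⟨g, hgP, hgl, hg1⟩ : ∃ g : A, P * g = p • g ∧ l * g = s • g ∧ g • w = w := by
    have hlP : l * P = P * l := h.P_l.symm.eq
    have hPl' : P * (P * l) = P * l := by rw [← mul_assoc, h.P_P]
    have hlPl : l * (P * l) = P * l := by rw [← mul_assoc, hlP, mul_assoc, h.l_l]
    have hP := hw.P_smul
    have hl := hw.l_smul
    rcases hd.block with ⟨rfl, rfl⟩ | ⟨rfl, rfl⟩ | ⟨rfl, rfl⟩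
    · exact ⟨1 - P - l + P * l, by simp [mul_add, mul_sub, h.P_P, hPl'],
        by simp [mul_add, mul_sub, hlP, h.l_l, hlPl], by simp [add_smul, sub_smul, mul_smul, hP, hl]⟩
    · exact ⟨l - P * l, by simp [mul_sub, hPl'], by simp [mul_sub, h.l_l, hlPl],
        by simp [sub_smul, mul_smul, hP, hl]⟩
    · exact ⟨P - P * l, by simp [mul_sub, hPl', h.P_P], by simp [mul_sub, hlP, hlPl],
        by simp [sub_smul, mul_smul, hP, hl]⟩
  -- ... and to the generalized weight space of `a`
  obtain ⟨d, b, hb, hdb⟩ : ∃ (d : ℕ) (b : K[X]), b.eval a ≠ 0 ∧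
      ∀ y : M, aeval T ((Polynomial.X - C a) ^ d) • aeval T b • y = 0 := by
    have hint : IsIntegral K (Algebra.lsmul K K M T) := Algebra.IsIntegral.isIntegral _
    obtain ⟨b, hb, hab⟩ :=
      exists_eq_pow_rootMultiplicity_mul_and_not_dvd _ (minpoly.ne_zero hint) a
    generalize rootMultiplicity a _ = d at hb
    refine ⟨d, b, fun h0 => hab (dvd_iff_isRoot.mpr h0), fun y => ?_⟩
    have h1 := minpoly.aeval K (Algebra.lsmul K K M T)
    rw [hb, aeval_algHom_apply] at h1
    rw [smul_smul, ← map_mul]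
    exact LinearMap.congr_fun h1 y
  set z := aeval T b • g • x with hz
  have hzb : z ∈ blockSubspace K M P l p s := by
    have hgx : g • x ∈ blockSubspace K M P l p s :=
      ⟨by rw [smul_smul, hgP, smul_assoc], by rw [smul_smul, hgl, smul_assoc]⟩
    exact smul_mem_blockSubspace (commute_aeval h.P_T b) (commute_aeval h.l_T b) hgx
  have hπz : π z = b.eval a • w := by
    rw [hz, map_smul, map_smul]
    change aeval T b • g • N.mkQ x = _
    rw [hx, hg1, QuantumTriple.aeval_smul_of_smul_eq hw.T_smul]
  have hzT : aeval T ((Polynomial.X - C a) ^ (d + 1)) • z = 0 := by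
    rw [pow_succ', map_mul, mul_smul, hdb, smul_zero]
  have hEz : E • z ∈ N := by
    rw [← Submodule.Quotient.mk_eq_zero]
    change π (E • z) = 0
    rw [map_smul, hπz, smul_algebra_smul_comm, hw.E_smul, smul_zero]
  obtain ⟨y, hyW, hEy, hyT⟩ := h.toQuantumTriple.exists_E_smul_eq hq0 hq
    (N.restrictScalars K ⊓ blockSubspace K M P l p s)
    (fun y hy => ⟨N.smul_mem E hy.1, smul_mem_blockSubspace h.P_E h.l_E hy.2⟩)
    (fun y hy => ⟨N.smul_mem F hy.1, smul_mem_blockSubspace h.P_F h.l_F hy.2⟩) hd.sq_eq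
    (u := E • z) ⟨hEz, smul_mem_blockSubspace h.P_E h.l_E hzb⟩
    (h.toQuantumTriple.aeval_smul_E_smul hzT)
  have hzy : z - y ∈ N := by
    by_cases h0 : z - y = 0
    · rw [h0]; exact N.zero_mem
    have hE0 : E • (z - y) = 0 := by rw [smul_sub, hEy, sub_self]
    have hT := h.toQuantumTriple.smul_eq_of_generalized hq0 hq hE0 hd.sq_eq (r := d + 1)
      (by rw [smul_sub, hzT, hyT, sub_zero])
    have hblock := (blockSubspace K M P l p s).sub_mem hzb hyW.2
    exact hmemN ⟨h0, hE0, hT, hblock.1, hblock.2⟩ hd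
  have hzN : z ∈ N := by
    have := N.add_mem hzy hyW.1
    rwa [sub_add_cancel] at this
  have h0 : π z = 0 := (Submodule.Quotient.mk_eq_zero N).mpr hzN
  rw [hπz, smul_eq_zero] at h0
  exact h0.elim hb hw.ne_zero

end MatrixTriple

/-! ### The Casimir element -/

namespace MatrixTriple

variable {K A M : Type*} [Field K] [Ring A] [Algebra K A] {q : K} {E F T T' P l X Y : A}
  [AddCommGroup M] [Module K M] [Module A M] [IsScalarTower K A M]

open BlockRelations (casimirFactor)

/-- The Casimir element of quantum `sl₂`. -/
def quantumCasimir (q : K) (E F T T' : A) : A :=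
  F * E + ((q - q⁻¹) ^ 2)⁻¹ • (q • T + q⁻¹ • T')

theorem commute_quantumCasimir (h : MatrixTriple q E F T T' P l X Y) {z : A} (hE : Commute z E)
    (hF : Commute z F) (hT : Commute z T) : Commute z (quantumCasimir q E F T T') :=
  (hF.mul_right hE).add_right
    (((hT.smul_right _).add_right ((h.commute_T' hT).smul_right _)).smul_right _)

theorem E_commute_quantumCasimir (h : MatrixTriple q E F T T' P l X Y) (hq0 : q ≠ 0)
    (hq2 : q - q⁻¹ ≠ 0) : Commute E (quantumCasimir q E F T T') := by
  have hEF : E * F = F * E + (q - q⁻¹)⁻¹ • (T - T') := by rw [← h.E_F]; abel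
  have hq1 : q ^ 2 - 1 ≠ 0 := by
    have : q * (q - q⁻¹) = q ^ 2 - 1 := by field_simp
    exact this ▸ mul_ne_zero hq0 hq2
  rw [Commute, SemiconjBy, quantumCasimir, mul_add, ← mul_assoc, hEF]
  simp only [add_mul, sub_mul, mul_add, mul_smul_comm, smul_mul_assoc, h.E_T hq0, h.E_T']
  match_scalars <;> field_simp <;> ring

theorem F_commute_quantumCasimir (h : MatrixTriple q E F T T' P l X Y) (hq0 : q ≠ 0)
    (hq2 : q - q⁻¹ ≠ 0) : Commute F (quantumCasimir q E F T T') := by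
  have hEF : E * F = F * E + (q - q⁻¹)⁻¹ • (T - T') := by rw [← h.E_F]; abel
  have hq1 : q ^ 2 - 1 ≠ 0 := by
    have : q * (q - q⁻¹) = q ^ 2 - 1 := by field_simp
    exact this ▸ mul_ne_zero hq0 hq2
  rw [Commute, SemiconjBy, quantumCasimir, add_mul, mul_assoc, hEF]
  simp only [add_mul, mul_sub, mul_add, mul_smul_comm, smul_mul_assoc, h.T_F hq0, h.F_T']
  match_scalars <;> field_simp <;> ring

theorem T_commute_quantumCasimir (h : MatrixTriple q E F T T' P l X Y) (hq0 : q ≠ 0) :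
    Commute T (quantumCasimir q E F T T') := by
  have hTT' : Commute T T' := by rw [Commute, SemiconjBy, h.T_T', h.T'_T]
  have hFE : Commute T (F * E) := by
    rw [Commute, SemiconjBy, ← mul_assoc, h.T_F hq0, smul_mul_assoc, mul_assoc, h.T_E,
      mul_smul_comm, smul_smul, ← mul_pow, inv_mul_cancel₀ hq0, one_pow, one_smul, mul_assoc]
  exact hFE.add_right
    ((((Commute.refl T).smul_right _).add_right (hTT'.smul_right _)).smul_right _)

theorem commute_casimirFactor {z : A} (hP : Commute z P) (hl : Commute z l) :
    Commute z (casimirFactor q P l) :=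
  ((((((Commute.one_right z).sub_right hl).smul_right _).add_right (hl.smul_right _)).sub_right
    (((hP.sub_right (hP.mul_right hl)).smul_right _).add_right
      ((hP.mul_right hl).smul_right _))).add_right hP)

theorem X_commute_casimirFactor (h : MatrixTriple q E F T T' P l X Y) :
    Commute X (casimirFactor q P l) := by
  rw [Commute, SemiconjBy, casimirFactor]
  simp only [add_mul, sub_mul, mul_add, mul_sub, mul_smul_comm, smul_mul_assoc, ← mul_assoc, h.X_l,
    h.X_P, h.l_X, h.P_X, mul_assoc P l X, mul_zero, mul_one, one_mul]
  module

theorem Y_commute_casimirFactor (h : MatrixTriple q E F T T' P l X Y) :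
    Commute Y (casimirFactor q P l) := by
  rw [Commute, SemiconjBy, casimirFactor]
  simp only [add_mul, sub_mul, mul_add, mul_sub, mul_smul_comm, smul_mul_assoc, ← mul_assoc, h.Y_l,
    h.Y_P, h.l_Y, h.P_Y, mul_assoc P l Y, mul_one, one_mul]
  module

theorem mem_center (h : MatrixTriple q E F T T' P l X Y)
    (hgen : Algebra.adjoin K ({E, F, T, T', P, l, X, Y} : Set A) = ⊤)
    (hq0 : q ≠ 0) (hq2 : q - q⁻¹ ≠ 0) :
    (q - q⁻¹) • (casimirFactor q P l * quantumCasimir q E F T T') ∈ Subalgebra.center K A := by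
  refine Subalgebra.smul_mem _ ?_ _
  rw [Subalgebra.mem_center_iff]
  intro b
  change Commute b _
  have hb : b ∈ Algebra.adjoin K ({E, F, T, T', P, l, X, Y} : Set A) := by
    rw [hgen]; exact Algebra.mem_top
  have hTc := (commute_casimirFactor (q := q) h.P_T.symm h.l_T.symm).mul_right
    (h.T_commute_quantumCasimir hq0)
  induction hb using Algebra.adjoin_induction with
  | mem g hg =>
    simp only [Set.mem_insert_iff, Set.mem_singleton_iff] at hg
    rcases hg with hg | hg | hg | hg | hg | hg | hg | hg <;> rw [hg]
    · exact (commute_casimirFactor h.P_E.symm h.l_E.symm).mul_right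
        (h.E_commute_quantumCasimir hq0 hq2)
    · exact (commute_casimirFactor h.P_F.symm h.l_F.symm).mul_right
        (h.F_commute_quantumCasimir hq0 hq2)
    · exact hTc
    · exact (h.commute_T' hTc.symm).symm
    · exact (commute_casimirFactor (Commute.refl P) h.P_l).mul_right
        (h.commute_quantumCasimir h.P_E h.P_F h.P_T)
    · exact (commute_casimirFactor h.P_l.symm (Commute.refl l)).mul_right
        (h.commute_quantumCasimir h.l_E h.l_F h.l_T)
    · exact h.X_commute_casimirFactor.mul_right (h.commute_quantumCasimir h.X_E h.X_F h.X_T)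
    · exact h.Y_commute_casimirFactor.mul_right (h.commute_quantumCasimir h.Y_E h.Y_F h.Y_T)
  | algebraMap c => exact Algebra.commutes c _
  | add b c _ _ hb hc => exact hb.add_left hc
  | mul b c _ _ hb hc => exact hb.mul_left hc

/-- The scalar by which the Casimir element acts on a highest weight vector. -/
def casimirScalar (q a p s : K) : K :=
  (q - q⁻¹) * ((q⁻¹ * (1 - s) + q * s - (q⁻¹ * (p - p * s) + q * (p * s)) + p) *
    (((q - q⁻¹) ^ 2)⁻¹ * (q * a + q⁻¹ * a⁻¹)))

theorem casimir_smul (h : MatrixTriple q E F T T' P l X Y) {w : M} {a p s : K} (ha : a ≠ 0)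
    (hw : IsHighestWeightVector E T P l w a p s) :
    ((q - q⁻¹) • (casimirFactor q P l * quantumCasimir q E F T T')) • w =
      casimirScalar q a p s • w := by
  have h1 : quantumCasimir q E F T T' • w = (((q - q⁻¹) ^ 2)⁻¹ * (q * a + q⁻¹ * a⁻¹)) • w := by
    rw [quantumCasimir, add_smul, mul_smul F E, hw.E_smul, smul_zero, zero_add, smul_assoc, add_smul,
      smul_assoc, smul_assoc, hw.T_smul, h.toQuantumTriple.T'_smul ha hw.T_smul]
    module
  have hPl : (P * l) • w = (p * s) • w := by
    rw [mul_smul, hw.l_smul, smul_algebra_smul_comm, hw.P_smul, smul_smul, mul_comm]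
  have h2 : casimirFactor q P l • w =
      (q⁻¹ * (1 - s) + q * s - (q⁻¹ * (p - p * s) + q * (p * s)) + p) • w := by
    simp only [casimirFactor, add_smul, sub_smul, smul_assoc, one_smul, hPl, hw.l_smul, hw.P_smul]
    module
  rw [smul_assoc, mul_smul, h1, smul_algebra_smul_comm, h2, casimirScalar]
  module

/-- The Casimir element acts by a scalar on a simple module with a highest weight vector. -/
theorem casimir_smul_eq [IsSimpleModule A M] (h : MatrixTriple q E F T T' P l X Y)
    (hgen : Algebra.adjoin K ({E, F, T, T', P, l, X, Y} : Set A) = ⊤)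
    (hq0 : q ≠ 0) (hq2 : q - q⁻¹ ≠ 0) {w : M} {a p s : K} (ha : a ≠ 0)
    (hw : IsHighestWeightVector E T P l w a p s) (x : M) :
    ((q - q⁻¹) • (casimirFactor q P l * quantumCasimir q E F T T')) • x =
      casimirScalar q a p s • x := by
  have hx : x ∈ Submodule.span A {w} := by
    rw [IsSimpleModule.span_singleton_eq_top A hw.ne_zero]
    exact Submodule.mem_top
  obtain ⟨b, rfl⟩ := Submodule.mem_span_singleton.mp hx
  have hc := Subalgebra.mem_center_iff.mp (h.mem_center hgen hq0 hq2) b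
  rw [smul_smul, ← hc, mul_smul, h.casimir_smul ha hw, smul_algebra_smul_comm]

end MatrixTriple

namespace BlockRelations

variable {K A : Type*} [Field K] [Ring A] [Algebra K A] {q : K} {E G k k' l x y : A}

theorem adjoin_eq_top (h : BlockRelations q E G k k' l x y) (hq0 : q ≠ 0) {P Z Z' e f : A}
    (hZ : Z = rescale q P l) (hZ' : Z' = rescale q⁻¹ P l)
    (m : MatrixTriple q E (Z * G) (Z * k) (k' * Z') P l (q • (x * k)) y)
    (he : e = E + x) (hf : f = G + y)
    (hgen : Algebra.adjoin K ({e, f, k, k', l} : Set A) = ⊤) :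
    Algebra.adjoin K ({E, Z * G, Z * k, k' * Z', P, l, q • (x * k), y} : Set A) = ⊤ := by
  have Z'Z : Z' * Z = 1 := by
    have := rescale_mul_rescale (q := q⁻¹) (inv_ne_zero hq0) m.P_P m.P_l h.l_l
    rw [inv_inv] at this
    rw [hZ, hZ', this]
  rw [← top_le_iff, ← hgen, Algebra.adjoin_le_iff]
  set S := Algebra.adjoin K ({E, Z * G, Z * k, k' * Z', P, l, q • (x * k), y} : Set A) with hS
  have hsub : ({E, Z * G, Z * k, k' * Z', P, l, q • (x * k), y} : Set A) ⊆ S :=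
    Algebra.subset_adjoin
  simp only [Set.insert_subset_iff, Set.singleton_subset_iff, SetLike.mem_coe] at hsub
  obtain ⟨hE, hG, hk, hk', hP, hl, hx, hy⟩ := hsub
  have hres : ∀ c : K, rescale c P l ∈ S := fun c =>
    S.add_mem (S.add_mem (S.sub_mem S.one_mem hP) (S.smul_mem (S.sub_mem hP (S.mul_mem hP hl)) _))
      (S.smul_mem (S.mul_mem hP hl) _)
  have hZS : Z ∈ S := hZ ▸ hres q
  have hZ'S : Z' ∈ S := hZ' ▸ hres q⁻¹
  have hkS : k ∈ S := by
    have := S.mul_mem hZ'S hk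
    rwa [mul_mul_eq_of_mul_eq_one Z'Z] at this
  have hk'S : k' ∈ S := by
    have := S.mul_mem hk' hZS
    rwa [mul_assoc, Z'Z, mul_one] at this
  have hGS : G ∈ S := by
    have := S.mul_mem hZ'S hG
    rwa [mul_mul_eq_of_mul_eq_one Z'Z] at this
  have hxS : x ∈ S := by
    have := S.smul_mem (S.mul_mem hx hk'S) q⁻¹
    rwa [smul_mul_assoc, mul_assoc, h.k_k', mul_one, smul_smul, inv_mul_cancel₀ hq0,
      one_smul] at this
  simp only [Set.insert_subset_iff, Set.singleton_subset_iff, SetLike.mem_coe]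
  exact ⟨he ▸ S.add_mem hE hxS, hf ▸ S.add_mem hGS hy, hkS, hk'S, hl⟩

end BlockRelations

/-! ### Separation of the Casimir scalars over `ℂ(v)` -/

theorem eq_of_C_mul_X_pow_add_X_pow_eq {ε ε' : ℂ} (hε : ε ≠ 0) {i j i' j' : ℕ}
    (hij : j < i) (hij' : j' < i')
    (h : C ε * (X ^ i + X ^ j) = C ε' * (X ^ i' + X ^ j')) : i = i' ∧ j = j' ∧ ε = ε' := by
  have hc : ∀ d : ℕ, ε * ((if d = i then 1 else 0) + (if d = j then 1 else 0)) =
      ε' * ((if d = i' then 1 else 0) + (if d = j' then 1 else 0)) := by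
    intro d
    have := congrArg (fun r => coeff r d) h
    simpa only [coeff_C_mul, coeff_add, coeff_X_pow] using this
  have hi : i = i' ∨ i = j' := by
    by_contra! hne
    simpa [hne.1, hne.2, hij.ne', hε] using hc i
  have hj : j = i' ∨ j = j' := by
    by_contra! hne
    simpa [hne.1, hne.2, hij.ne, hε] using hc j
  have h1 : i = i' := by omega
  have h2 : j = j' := by omega
  subst h1 h2
  refine ⟨rfl, rfl, ?_⟩
  simpa [hij.ne'] using hc i

namespace MirabolicSl2

theorem v_ne_zero : v ≠ 0 := RatFunc.X_ne_zero

theorem v_pow_eq (n : ℕ) : v ^ n = algebraMap ℂ[X] (RatFunc ℂ) (X ^ n) := by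
  rw [v, map_pow, RatFunc.algebraMap_X]

theorem v_pow_ne_one (n : ℕ) (hn : 0 < n) : v ^ n ≠ 1 := by
  rw [v_pow_eq, ← map_one (algebraMap ℂ[X] (RatFunc ℂ))]
  intro h
  have := congrArg natDegree (RatFunc.algebraMap_injective ℂ h)
  simp at this
  omega

/-- A label is determined by its Casimir scalar. Up to a common factor, the Casimir scalar is
`± (v ^ (n + j) + v ^ (j - n - 2))` with `j = 0, 1, 2` depending on the block, so its two
exponents determine `n` and `j`. -/
theorem label_eq_of_casimirScalar_eq {n n' : ℕ} {a p s a' p' s' : Kv}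
    (h : IsDominantLabel v n a p s) (h' : IsDominantLabel v n' a' p' s')
    (heq : MatrixTriple.casimirScalar v a p s = MatrixTriple.casimirScalar v a' p' s') :
    a = a' ∧ p = p' ∧ s = s' := by
  have hv0 := v_ne_zero
  have hv2 := QuantumTriple.sub_inv_ne_zero v_ne_zero v_pow_ne_one
  have hsign : ∀ {m : ℕ} {b r t : Kv}, IsDominantLabel v m b r t →
      ∃ (ε : ℂ) (j : ℕ), ε ≠ 0 ∧ b = algebraMap ℂ[X] (RatFunc ℂ) (C ε) * v ^ m ∧
        ((r = 0 ∧ t = 0 ∧ j = 0) ∨ (r = 1 ∧ t = 0 ∧ j = 1) ∨ (r = 0 ∧ t = 1 ∧ j = 2)) ∧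
        (v - v⁻¹) * MatrixTriple.casimirScalar v b r t * v ^ (m + 2) =
          algebraMap ℂ[X] (RatFunc ℂ) (C ε) * (v ^ (2 * m + 2 + j) + v ^ j) := by
    intro m b r t hb
    have hvm := pow_ne_zero m hv0
    obtain ⟨ε, hε, hbε⟩ : ∃ ε : ℂ, ε * ε = 1 ∧ b = algebraMap ℂ[X] (RatFunc ℂ) (C ε) * v ^ m := by
      have h1 : b ^ 2 = (v ^ m) ^ 2 := by rw [hb.sq_eq, ← pow_mul, mul_comm]
      rcases sq_eq_sq_iff_eq_or_eq_neg.mp h1 with h2 | h2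
      · exact ⟨1, by norm_num, by simp [h2]⟩
      · exact ⟨-1, by norm_num, by simp [h2]⟩
    set ε' := algebraMap ℂ[X] (RatFunc ℂ) (C ε) with hε'
    have hεε : ε' * ε' = 1 := by rw [hε', ← map_mul, ← C_mul, hε, C_1, map_one]
    have hinv : b⁻¹ = ε' * (v ^ m)⁻¹ := by
      rw [hbε, mul_inv, ← eq_inv_of_mul_eq_one_left hεε]
    have hε0 : ε ≠ 0 := by rintro rfl; simp at hε
    have hscal : ∀ d : Kv, (v - v⁻¹) * ((v - v⁻¹) * (d * (((v - v⁻¹) ^ 2)⁻¹ *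
        (v * b + v⁻¹ * b⁻¹)))) * v ^ (m + 2) = ε' * (d * v) * (v ^ (2 * m + 2) + 1) := by
      intro d
      have e1 : (v - v⁻¹) * ((v - v⁻¹) * (d * (((v - v⁻¹) ^ 2)⁻¹ *
        (v * b + v⁻¹ * b⁻¹)))) * v ^ (m + 2) =
        ((v - v⁻¹) ^ 2 * ((v - v⁻¹) ^ 2)⁻¹) * (d * (v * b + v⁻¹ * b⁻¹) * v ^ (m + 2)) := by ring
      rw [e1, mul_inv_cancel₀ (pow_ne_zero 2 hv2), hinv, hbε]
      field_simp
      ring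
    rcases hb.block with ⟨rfl, rfl⟩ | ⟨rfl, rfl⟩ | ⟨rfl, rfl⟩
    · refine ⟨ε, 0, hε0, hbε, Or.inl ⟨rfl, rfl, rfl⟩, ?_⟩
      rw [MatrixTriple.casimirScalar, hscal]
      field_simp
      ring
    · refine ⟨ε, 2, hε0, hbε, Or.inr (Or.inr ⟨rfl, rfl, rfl⟩), ?_⟩
      rw [MatrixTriple.casimirScalar, hscal]
      field_simp
      ring
    · refine ⟨ε, 1, hε0, hbε, Or.inr (Or.inl ⟨rfl, rfl, rfl⟩), ?_⟩
      rw [MatrixTriple.casimirScalar, hscal]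
      field_simp
      ring
  obtain ⟨ε, j, hε, ha, hblock, hc⟩ := hsign h
  obtain ⟨ε', j', -, ha', hblock', hc'⟩ := hsign h'
  have key : algebraMap ℂ[X] (RatFunc ℂ) (C ε) * (v ^ (2 * n + 2 + j) + v ^ j) * v ^ n' =
      algebraMap ℂ[X] (RatFunc ℂ) (C ε') * (v ^ (2 * n' + 2 + j') + v ^ j') * v ^ n := by
    rw [← hc, ← hc', heq]
    ring
  have key2 : C ε * (X ^ (2 * n + 2 + j + n') + X ^ (j + n')) =
      C ε' * (X ^ (2 * n' + 2 + j' + n) + X ^ (j' + n)) := by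
    apply RatFunc.algebraMap_injective ℂ
    simp only [map_mul, map_add, ← v_pow_eq]
    simp only [pow_add _ _ n', pow_add _ _ n]
    linear_combination key
  obtain ⟨h1, h2, h3⟩ := eq_of_C_mul_X_pow_add_X_pow_eq hε (by omega) (by omega) key2
  have hn : n = n' := by omega
  have hj : j = j' := by omega
  refine ⟨by rw [ha, ha', h3, hn], ?_⟩
  rcases hblock with ⟨r1, r2, r3⟩ | ⟨r1, r2, r3⟩ | ⟨r1, r2, r3⟩ <;>
  rcases hblock' with ⟨t1, t2, t3⟩ | ⟨t1, t2, t3⟩ | ⟨t1, t2, t3⟩ <;>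
  first
  | exact ⟨r1.trans t1.symm, r2.trans t2.symm⟩
  | (exfalso; omega)

end MirabolicSl2

/-! ### Application to `MU` -/

namespace MU

open MirabolicSl2

/-- The projection from the free algebra onto `MU`. -/
noncomputable def proj : FreeAlgebra Kv Gen →ₐ[Kv] MU := RingQuot.mkAlgHom Kv Rel

theorem proj_ι (g : Gen) : proj (FreeAlgebra.ι Kv g) = gen g := rfl

theorem proj_eq {a b : FreeAlgebra Kv Gen} (h : Rel a b) : proj a = proj b :=
  RingQuot.mkAlgHom_rel Kv h

theorem proj_surjective : Function.Surjective proj := RingQuot.mkAlgHom_surjective Kv Rel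

theorem qInt_two : qInt 2 = v + v⁻¹ := by
  rw [qInt, div_eq_iff (QuantumTriple.sub_inv_ne_zero v_ne_zero v_pow_ne_one)]
  ring

theorem mirabolicRelations : MirabolicRelations v e f k kInv l where
  k_k' := by simpa [proj_ι, e, f, k, kInv, l] using proj_eq Rel.k_kInv
  k'_k := by simpa [proj_ι, e, f, k, kInv, l] using proj_eq Rel.kInv_k
  k_e := by simpa only [map_mul, map_smul, proj_ι, e, f, k, kInv, l] using proj_eq Rel.k_e
  k_f := by simpa only [map_mul, map_smul, proj_ι, e, f, k, kInv, l] using proj_eq Rel.k_f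
  e_f := by simpa only [map_mul, map_smul, map_sub, proj_ι, e, f, k, kInv, l] using proj_eq Rel.e_f
  l_l := by simpa only [map_mul, pow_two, proj_ι, e, f, k, kInv, l] using proj_eq Rel.l_l
  k_l := by simpa only [map_mul, proj_ι, e, f, k, kInv, l] using proj_eq Rel.k_l
  l_e_l := by simpa only [map_mul, proj_ι, e, f, k, kInv, l] using proj_eq Rel.l_e_l
  l_f_l := by simpa only [map_mul, proj_ι, e, f, k, kInv, l] using proj_eq Rel.l_f_l
  e_l_e := by
    simpa only [map_mul, map_smul, map_add, pow_two, qInt_two, proj_ι, ← mul_assoc, e, f, l] using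
      proj_eq Rel.e_l_e
  f_l_f := by
    simpa only [map_mul, map_smul, map_add, pow_two, qInt_two, proj_ι, ← mul_assoc, e, f, l] using
      proj_eq Rel.f_l_f

theorem adjoin_generators : Algebra.adjoin Kv ({e, f, k, kInv, l} : Set MU) = ⊤ := by
  have h1 : (Algebra.adjoin Kv (Set.range (FreeAlgebra.ι Kv (X := Gen)))).map proj = ⊤ := by
    rw [FreeAlgebra.adjoin_range_ι, Algebra.map_top, AlgHom.range_eq_top]
    exact proj_surjective
  rw [AlgHom.map_adjoin] at h1
  rw [← top_le_iff, ← h1]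
  apply Algebra.adjoin_mono
  rintro _ ⟨_, ⟨g, rfl⟩, rfl⟩
  rw [proj_ι]
  cases g
  · exact Or.inl rfl
  · exact Or.inr (Or.inl rfl)
  · exact Or.inr (Or.inr (Or.inl rfl))
  · exact Or.inr (Or.inr (Or.inr (Or.inl rfl)))
  · exact Or.inr (Or.inr (Or.inr (Or.inr rfl)))

/-- `MU` is generated by a quantum triple together with commuting matrix units, and its Casimir
element is the corresponding product. -/
theorem exists_matrixTriple : ∃ E F T T' P X Y : MU, MatrixTriple v E F T T' P l X Y ∧
    Algebra.adjoin Kv ({E, F, T, T', P, l, X, Y} : Set MU) = ⊤ ∧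
    casimir = (v - v⁻¹) • (BlockRelations.casimirFactor v P l *
      MatrixTriple.quantumCasimir v E F T T') := by
  have hq0 := v_ne_zero
  have hq2 := QuantumTriple.sub_inv_ne_zero v_ne_zero v_pow_ne_one
  have hq4 : v ^ 2 + 1 ≠ 0 := by
    intro h0
    apply v_pow_ne_one 4 (by norm_num)
    linear_combination (v ^ 2 - 1) * h0
  have hb := mirabolicRelations.blockRelations hq0
  have he : e = (e - (e * l - l * e)) + (e * l - l * e) := by abel
  have hf : f = (f - (l * f - f * l)) + (l * f - f * l) := by abel
  have hm := hb.matrixTriple hq0 hq2 hq4 rfl rfl rfl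
  exact ⟨_, _, _, _, _, _, _, hm, hb.adjoin_eq_top hq0 rfl rfl hm he hf adjoin_generators,
    hb.casimir_eq hq0 hq2 rfl rfl hm he hf⟩

end MU

end

theorem mainTheorem2 :
    -- the mirabolic Casimir element is central
    MU.casimir ∈ Subalgebra.center Kv MU ∧
    -- it acts by a scalar on every finite-dimensional simple module
    (∀ (M : Type u) [AddCommGroup M] [Module Kv M] [Module MU M] [IsScalarTower Kv MU M]
      [FiniteDimensional Kv M] [IsSimpleModule MU M],
      ∃ c : Kv, ∀ m : M, MU.casimir • m = c • m) ∧
    -- the scalars on non-isomorphic finite-dimensional simple modules are distinct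
    (∀ (M : Type u) [AddCommGroup M] [Module Kv M] [Module MU M] [IsScalarTower Kv MU M]
      [FiniteDimensional Kv M] [IsSimpleModule MU M]
      (N : Type w) [AddCommGroup N] [Module Kv N] [Module MU N] [IsScalarTower Kv MU N]
      [FiniteDimensional Kv N] [IsSimpleModule MU N] (c d : Kv),
      (∀ m : M, MU.casimir • m = c • m) → (∀ n : N, MU.casimir • n = d • n) →
      IsEmpty (M ≃ₗ[MU] N) → c ≠ d) ∧
    -- every finite-dimensional module is a direct sum of simple modules
    (∀ (M : Type u) [AddCommGroup M] [Module Kv M] [Module MU M] [IsScalarTower Kv MU M]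
      [FiniteDimensional Kv M],
      ∃ (r : ℕ) (S : Fin r → Submodule MU M),
        (∀ i, IsSimpleModule MU (S i)) ∧ DirectSum.IsInternal S) := by
  have hq0 := MirabolicSl2.v_ne_zero
  have hq := MirabolicSl2.v_pow_ne_one
  have hq2 := QuantumTriple.sub_inv_ne_zero hq0 hq
  obtain ⟨E, F, T, T', P, X, Y, h, hgen, hcas⟩ := MU.exists_matrixTriple
  rw [hcas]
  refine ⟨h.mem_center hgen hq0 hq2, ?_, ?_, ?_⟩
  · intro M _ _ _ _ _ _
    have := IsSimpleModule.nontrivial MU M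
    obtain ⟨x, n, a, p, s, hx, hd⟩ := h.exists_isHighestWeightVector (M := M) hq0 hq
    exact ⟨_, h.casimir_smul_eq hgen hq0 hq2 (hd.ne_zero hq0) hx⟩
  · intro M _ _ _ _ _ _ N _ _ _ _ _ _ c d hc hd' hMN hcd
    have := IsSimpleModule.nontrivial MU M
    have := IsSimpleModule.nontrivial MU N
    obtain ⟨x, n, a, p, s, hx, hd⟩ := h.exists_isHighestWeightVector (M := M) hq0 hq
    obtain ⟨x', n', a', p', s', hx', hd₁⟩ := h.exists_isHighestWeightVector (M := N) hq0 hq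
    have h1 : c = MatrixTriple.casimirScalar MirabolicSl2.v a p s := by
      have h2 := hc x
      rw [h.casimir_smul (hd.ne_zero hq0) hx] at h2
      exact (smul_left_injective Kv hx.ne_zero h2).symm
    have h1' : d = MatrixTriple.casimirScalar MirabolicSl2.v a' p' s' := by
      have h2 := hd' x'
      rw [h.casimir_smul (hd₁.ne_zero hq0) hx'] at h2
      exact (smul_left_injective Kv hx'.ne_zero h2).symm
    obtain ⟨rfl, rfl, rfl⟩ := MirabolicSl2.label_eq_of_casimirScalar_eq hd hd₁
      (h1.symm.trans (hcd.trans h1'))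
    obtain ⟨φ⟩ := h.nonempty_linearEquiv hgen hq0 hq hx hx' hd
    exact hMN.false φ
  · intro M _ _ _ _ _
    have := h.isSemisimpleModule (M := M) hgen hq0 hq
    obtain ⟨t, hind, htop, hsimple⟩ := IsSemisimpleModule.exists_sSupIndep_sSup_simples_eq_top MU M
    have : Module.Finite MU M := Module.Finite.of_restrictScalars_finite Kv MU M
    have hfin : Finite t := WellFoundedGT.finite_of_sSupIndep hind
    have e := Finite.equivFin t
    refine ⟨Nat.card t, fun i => (e.symm i : Submodule MU M), fun i => hsimple _ (e.symm i).2, ?_⟩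
    refine DirectSum.isInternal_submodule_of_iSupIndep_of_iSup_eq_top ?_ ?_
    · exact ((sSupIndep_iff t).mp hind).comp e.symm.injective
    · rw [e.symm.iSup_comp (g := fun m : t => (m : Submodule MU M)), ← sSup_eq_iSup', htop]
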